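/- Let $k$ be a field of characteristic $p>0$, $R=k[[x_1,x_2,x_3]]$, $I=(x_1x_2,\,x_2x_3)\subset R$ and $S=R/I$. For a commutative ring $A$, an $A$-module $M$ and $e\ge 0$ let $\mathcal F^e(M)$ be the group of additive maps $\varphi:M\to M$ with $\varphi(rx)=r^{p^e}\varphi(x)$ for all $r\in A$, $x\in M$, and let $\mathcal F(M)=\bigoplus_{e\ge 0}\mathcal F^e(M)$, a graded ring under composition. For a local ring $A$ let $E_A$ be the injective hull of its residue field. Let $$U=\{Q\in\operatorname{Spec}(S) : \mathcal F(E_{S_Q})\text{ is finitely generated over }\mathcal F^0(E_{S_Q})\},$$ where finitely generated means that finitely many elements generate $\mathcal F(E_{S_Q})$ as a ring together with $\mathcal F^0(E_{S_Q})=\operatorname{Hom}_{S_Q}(E_{S_Q},E_{S_Q})\cong\widehat{S_Q}$. Let $I^{[p]}$ be the ideal generated by the $p$-th powers of the elements of $I$, let $x^\beta$ be the product of the variables that lie in the sum of the minimal primes of $I$ (here $x^\beta=x_1x_2x_3$), and let $J_p$ be the ideal of $R$ generated by the minimal monomial generators of $(I^{[p]}:_R I)$ that do not lie in $I^{[p]}+((x^\beta)^{p-1})$,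 so that $(I^{[p]}:_RI)=I^{[p]}+J_p+((x^\beta)^{p-1})$. Let $$U'=\operatorname{Spec}(S)\setminus V\big(\operatorname{Ann}_S((I^{[p]}+J_p)/I^{[p]})\big).$$ Then $U'\subsetneq U$. Moreover $U=\operatorname{Spec}(S)\setminus\{\mathfrak m\}$, where $\mathfrak m$ is the maximal ideal of the local ring $S$; in particular $U$ is open in $\operatorname{Spec}(S)$. -/

import Mathlib

universe u

open scoped DirectSum

namespace FrobeniusLocus

/-! ### Injective hulls -/

/-- `ι : M → E` is an injective hull of the `A`-module `M`: the map `ι` is injective, `E` is an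
injective module, and `E` is an essential extension of the image of `M`, that is, every nonzero
submodule of `E` meets that image nontrivially. -/
structure IsInjectiveHull {A : Type u} [CommRing A] {M E : Type u} [AddCommGroup M] [Module A M]
    [AddCommGroup E] [Module A E] (ι : M →ₗ[A] E) : Prop where
  injective : Function.Injective ι
  injective_module : Module.Injective A E
  essential : ∀ N : Submodule A E, N ≠ ⊥ → N ⊓ LinearMap.range ι ≠ ⊥

/-- A module that embeds in an injective module has an injective hull. -/
theorem exists_isInjectiveHull_of_injective {A : Type u} [CommRing A] {M J : Type u}
    [AddCommGroup M] [Module A M] [AddCommGroup J] [Module A J] (hJ : Module.Injective A J)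
    (f : M →ₗ[A] J) (hf : Function.Injective f) :
    ∃ (E : Type u) (_ : AddCommGroup E) (_ : Module A E) (ι : M →ₗ[A] E), IsInjectiveHull ι := by
  set L := LinearMap.range f with hL
  obtain ⟨N, hLN, hN⟩ := zorn_le_nonempty₀
    {N : Submodule A J | L ≤ N ∧ ∀ N' ≤ N, N' ≠ ⊥ → N' ⊓ L ≠ ⊥}
    (by
      intro c hc hch y hy
      refine ⟨sSup c, ⟨(hc hy).1.trans (le_sSup hy), fun N' hN' hne h0 => ?_⟩,
        fun z hz => le_sSup hz⟩
      obtain ⟨x, hx, hx0⟩ := N'.ne_bot_iff.1 hne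
      obtain ⟨z, hz, hxz⟩ := (Submodule.mem_sSup_of_directed ⟨y, hy⟩ hch.directedOn).1 (hN' hx)
      have h1 := (hc hz).2 (Submodule.span A {x}) (by simpa using hxz) (by simpa using hx0)
      refine h1 (eq_bot_iff.2 (le_trans ?_ h0.le))
      exact inf_le_inf_right _ (by simpa using hx)) L
    ⟨le_rfl, fun N' hN' hne => by rwa [inf_eq_left.2 hN']⟩
  obtain ⟨T, -, hT⟩ := zorn_le_nonempty₀ {T : Submodule A J | T ⊓ N = ⊥}
    (by
      intro c hc hch y hy
      refine ⟨sSup c, eq_bot_iff.2 fun x hx => ?_, fun z hz => le_sSup hz⟩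
      obtain ⟨z, hz, hxz⟩ := (Submodule.mem_sSup_of_directed ⟨y, hy⟩ hch.directedOn).1 hx.1
      exact (hc hz).le ⟨hxz, hx.2⟩) ⊥ (bot_inf_eq _)
  have hTN : T ⊓ N = ⊥ := hT.prop
  have hq : Function.Injective (T.mkQ ∘ₗ N.subtype) := by
    rw [← LinearMap.ker_eq_bot, LinearMap.ker_eq_bot']
    intro n hn
    have : (n : J) ∈ T ⊓ N := ⟨by simpa using hn, n.2⟩
    rw [hTN] at this
    simpa using this
  obtain ⟨h, hh⟩ := hJ.out (T.mkQ ∘ₗ N.subtype) hq N.subtype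
  have hid : ∀ n ∈ N, h (T.mkQ n) = n := fun n hn => hh ⟨n, hn⟩
  have hrange : LinearMap.range h ≤ N := by
    refine hN.le_of_ge ⟨?_, ?_⟩ ?_
    · exact fun x hx => ⟨T.mkQ x, hid x (hLN hx)⟩
    · intro N' hN' hne
      have h1 : N' ⊓ N ≠ ⊥ := by
        intro h0
        have hle' : N'.comap (h ∘ₗ T.mkQ) ≤ T := by
          refine hT.le_of_ge ?_ ?_
          · refine eq_bot_iff.2 fun x hx => ?_
            have h2 : h (T.mkQ x) ∈ N' := hx.1
            rw [hid x hx.2] at h2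
            exact h0.le ⟨h2, hx.2⟩
          · intro x hx
            have : T.mkQ x = 0 := by simpa using hx
            simp [LinearMap.comp_apply, this]
        obtain ⟨x, hx, hx0⟩ := N'.ne_bot_iff.1 hne
        obtain ⟨y, rfl⟩ := hN' hx
        obtain ⟨z, rfl⟩ := T.mkQ_surjective y
        have hz : z ∈ T := hle' hx
        have : T.mkQ z = 0 := by simpa using hz
        exact hx0 (by rw [this, map_zero])
      have h2 := hN.prop.2 (N' ⊓ N) inf_le_right h1
      intro h3
      exact h2 (eq_bot_iff.2 ((inf_le_inf_right _ inf_le_left).trans h3.le))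
    · exact fun x hx => ⟨T.mkQ x, hid x hx⟩
  let r : J →ₗ[A] N := (h ∘ₗ T.mkQ).codRestrict N fun x => hrange ⟨_, rfl⟩
  have hr : ∀ n : N, r n = n := fun n => Subtype.ext (hid n n.2)
  refine ⟨N, inferInstance, inferInstance, f.codRestrict N fun x => hLN ⟨x, rfl⟩, ?_, ?_, ?_⟩
  · intro x y hxy
    exact hf (congrArg Subtype.val hxy)
  · refine ⟨fun X Y _ _ _ _ i hi g => ?_⟩
    obtain ⟨g', hg'⟩ := hJ.out i hi (N.subtype ∘ₗ g)
    refine ⟨r ∘ₗ g', fun x => ?_⟩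
    rw [LinearMap.comp_apply, hg', LinearMap.comp_apply, Submodule.subtype_apply, hr]
  · intro K hK h0
    refine hN.prop.2 (K.map N.subtype) (Submodule.map_subtype_le N K)
      (fun h1 => hK (Submodule.map_injective_of_injective N.subtype_injective
        (h1.trans (Submodule.map_bot _).symm))) ?_
    refine eq_bot_iff.2 ?_
    rintro _ ⟨⟨x, hx, rfl⟩, y, hy⟩
    have hmem : x ∈ K ⊓ LinearMap.range (f.codRestrict N fun x => hLN ⟨x, rfl⟩) :=
      ⟨hx, y, Subtype.ext hy⟩
    rw [h0, Submodule.mem_bot] at hmem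
    simp [hmem]

/-- Every module has an injective hull. -/
theorem exists_isInjectiveHull (A : Type u) [CommRing A] (M : Type u) [AddCommGroup M]
    [Module A M] :
    ∃ (E : Type u) (_ : AddCommGroup E) (_ : Module A E) (ι : M →ₗ[A] E), IsInjectiveHull ι := by
  obtain ⟨P⟩ := CategoryTheory.EnoughInjectives.presentation (ModuleCat.of A M)
  have hJ : CategoryTheory.Injective (ModuleCat.of A P.J) := P.injective
  exact exists_isInjectiveHull_of_injective (Module.injective_module_of_injective_object A P.J)
    P.f.hom ((ModuleCat.mono_iff_injective _).1 P.mono)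

section Hull

variable (A : Type u) [CommRing A] (M : Type u) [AddCommGroup M] [Module A M]

/-- The injective hull `E_A(M)` of an `A`-module `M` (unique up to isomorphism). -/
def InjectiveHull : Type u := (exists_isInjectiveHull A M).choose

noncomputable instance : AddCommGroup (InjectiveHull A M) :=
  (exists_isInjectiveHull A M).choose_spec.choose

noncomputable instance : Module A (InjectiveHull A M) :=
  (exists_isInjectiveHull A M).choose_spec.choose_spec.choose

/-- The embedding of `M` in its injective hull. -/
noncomputable def InjectiveHull.ι : M →ₗ[A] InjectiveHull A M :=
  (exists_isInjectiveHull A M).choose_spec.choose_spec.choose_spec.choose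

theorem InjectiveHull.isInjectiveHull : IsInjectiveHull (InjectiveHull.ι A M) :=
  (exists_isInjectiveHull A M).choose_spec.choose_spec.choose_spec.choose_spec

end Hull

/-! ### The Frobenius algebra of a module -/

section FrobeniusAlgebra

variable (p : ℕ) (A : Type u) [CommRing A] (M : Type u) [AddCommGroup M] [Module A M]

/-- `𝓕ᵉ(M)`: the additive maps `φ : M → M` with `φ (r x) = r ^ (p ^ e) φ x`. -/
def frobeniusMaps (e : ℕ) : AddSubgroup (AddMonoid.End M) where
  carrier := {φ | ∀ (r : A) (x : M), φ (r • x) = r ^ p ^ e • φ x}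
  zero_mem' := fun r x => by simp
  add_mem' := fun {φ ψ} hφ hψ r x => by
    change φ (r • x) + ψ (r • x) = r ^ p ^ e • (φ x + ψ x)
    rw [hφ, hψ, smul_add]
  neg_mem' := fun {φ} hφ r x => by
    change -φ (r • x) = r ^ p ^ e • -φ x
    rw [hφ, smul_neg]

/-- Composition maps `𝓕ᵉ(M) × 𝓕ᵉ'(M)` to `𝓕ᵉ⁺ᵉ'(M)`. -/
instance : SetLike.GradedMonoid (frobeniusMaps p A M) where
  one_mem := fun r x => by simp
  mul_mem := fun e e' φ ψ hφ hψ r x => by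
    change φ (ψ (r • x)) = r ^ p ^ (e + e') • φ (ψ x)
    rw [hψ r x, hφ, ← pow_mul, ← pow_add, add_comm]

/-- The Frobenius algebra `𝓕(M) = ⨁ₑ 𝓕ᵉ(M)`, a (noncommutative) `ℕ`-graded ring whose
multiplication is composition. -/
abbrev FrobeniusAlgebra : Type u := ⨁ e : ℕ, frobeniusMaps p A M e

/-- `𝓕(M)` is finitely generated as an algebra over its degree zero part
`𝓕⁰(M) = Hom_A(M, M)`: finitely many elements generate it together with `𝓕⁰(M)` as a ring. -/
def FrobeniusAlgebraFG : Prop :=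
  ∃ T : Finset (FrobeniusAlgebra p A M),
    Subring.closure
      (Set.range (DirectSum.of (fun e : ℕ => frobeniusMaps p A M e) 0) ∪ (T : Set _)) = ⊤

end FrobeniusAlgebra

/-- The finitely generated locus `U` of a ring `S`: the primes `Q` such that the Frobenius algebra
of the injective hull of the residue field of `S_Q` is finitely generated (over its degree zero
part, which by Matlis duality is the completion of `S_Q` when `S` is noetherian). -/
def fgLocus (p : ℕ) (S : Type u) [CommRing S] : Set (PrimeSpectrum S) :=
  {Q | FrobeniusAlgebraFG p (Localization.AtPrime Q.asIdeal)
    (InjectiveHull (Localization.AtPrime Q.asIdeal)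
      (IsLocalRing.ResidueField (Localization.AtPrime Q.asIdeal)))}

/-! ### The open set `U'` attached to a square-free monomial ideal -/

/-- The ideal `I^[q]` generated by the `q`-th powers of the elements of `I`. -/
def frobeniusPower {R : Type u} [CommRing R] (q : ℕ) (I : Ideal R) : Ideal R :=
  Ideal.span ((fun a => a ^ q) '' (I : Set R))

section Monomial

variable {k : Type u} [Field k] {n : ℕ}

/-- The monomial `x^β`: the product of the variables that lie in the sum of the minimal primes
of `I`. (For a square-free monomial ideal the minimal primes are the ideals generated by sets
of variables that make up the minimal primary decomposition of `I`.) -/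
noncomputable def betaMonomial (I : Ideal (MvPowerSeries (Fin n) k)) : MvPowerSeries (Fin n) k :=
  open Classical in
  ∏ i ∈ Finset.univ.filter
    (fun i : Fin n => (MvPowerSeries.X i : MvPowerSeries (Fin n) k) ∈ sSup I.minimalPrimes),
    MvPowerSeries.X i

/-- The ideal `J_p`: it is generated by the monomials that lie in `(I^[p] : I)` but not in
`I^[p] + ((x^β)^(p-1))`. Since all these ideals are monomial when `I` is, this is the ideal generated
by those minimal monomial generators of `(I^[p] : I)` that are not in `I^[p] + ((x^β)^(p-1))`. -/
noncomputable def idealJ (p : ℕ) (I : Ideal (MvPowerSeries (Fin n) k)) :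
    Ideal (MvPowerSeries (Fin n) k) :=
  Ideal.span {m | (∃ c : Fin n →₀ ℕ, m = MvPowerSeries.monomial c (1 : k)) ∧
    m ∈ (frobeniusPower p I).colon (I : Set (MvPowerSeries (Fin n) k)) ∧
    m ∉ frobeniusPower p I ⊔ Ideal.span {betaMonomial I ^ (p - 1)}}

/-- The module `(I^[p] + J_p) / I^[p]`. -/
abbrev ModuleJ (p : ℕ) (I : Ideal (MvPowerSeries (Fin n) k)) : Type u :=
  ↥(frobeniusPower p I ⊔ idealJ p I) ⧸
    (frobeniusPower p I).submoduleOf (frobeniusPower p I ⊔ idealJ p I)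

/-- The open set `U' = Spec S ∖ V(Ann((I^[p] + J_p) / I^[p]))` for `S = R/I`. The module is killed
by `I`, and its annihilator in `S` is the image of its annihilator in `R`. -/
def openSubset (p : ℕ) (I : Ideal (MvPowerSeries (Fin n) k)) :
    Set (PrimeSpectrum (MvPowerSeries (Fin n) k ⧸ I)) :=
  (PrimeSpectrum.zeroLocus
    ((Module.annihilator (MvPowerSeries (Fin n) k) (ModuleJ p I)).map
      (Ideal.Quotient.mk I) : Set (MvPowerSeries (Fin n) k ⧸ I)))ᶜ

end Monomial

/-! ### The example -/

section Example

variable (k : Type u) [Field k]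

/-- The ideal `(x₁x₂, x₂x₃)` of `k[[x₁, x₂, x₃]]`; the variables are numbered from `0`. -/
noncomputable def exampleIdeal : Ideal (MvPowerSeries (Fin 3) k) :=
  Ideal.span {MvPowerSeries.X 0 * MvPowerSeries.X 1, MvPowerSeries.X 1 * MvPowerSeries.X 2}

/-- The ring `S = k[[x₁, x₂, x₃]] / (x₁x₂, x₂x₃)`. -/
abbrev ExampleRing : Type u := MvPowerSeries (Fin 3) k ⧸ exampleIdeal k

theorem exampleIdeal_ne_top : exampleIdeal k ≠ ⊤ := by
  intro h
  have hle : exampleIdeal k ≤ RingHom.ker (MvPowerSeries.constantCoeff (σ := Fin 3) (R := k)) := by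
    rw [exampleIdeal, Ideal.span_le]
    rintro x (rfl | rfl) <;> simp [RingHom.mem_ker]
  rw [h, top_le_iff, Ideal.eq_top_iff_one, RingHom.mem_ker, map_one] at hle
  exact one_ne_zero hle

instance : IsLocalRing (ExampleRing k) :=
  have : Nontrivial (ExampleRing k) := Ideal.Quotient.nontrivial_iff.2 (exampleIdeal_ne_top k)
  IsLocalRing.of_surjective' (Ideal.Quotient.mk (exampleIdeal k)) Ideal.Quotient.mk_surjective

end Example

end FrobeniusLocus

/-! Write x, y, z for `X 0`, `X 1`, `X 2`, so that xy = yz = 0 in S.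

A prime Q other than 𝔪 omits some variable. That variable becomes a unit in S_Q, so the relations
kill the variables it multiplies to zero. What remains is a local domain with principal maximal
ideal t. There the hull E is the union of cyclic modules A s_n with t s_{n+1} = s_n and Ann(s_n) =
(tⁿ), or is one-dimensional if t = 0. The rule r s_n ↦ r^p s_{pn} defines Φ of degree 1. Every φ of
degree e factors through Φ^e, because r s_{qn} = 0 with q = p^e forces r to be a multiple of a q-th
power of an element killing s_n. So Φ generates (`frobeniusAlgebraFG_of_isPrincipal`).

At 𝔪, the kernel of y in E behaves like the inverse polynomials in x and z, with s_n in the role of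
x⁻ⁿz⁻ⁿ (`IsInjectiveHull.exists_dual_system`). A product of Frobenius maps of positive degrees with
total degree e sends every v killed by z and x² to an element killed by (xz)^(p^e - 1)
(`frobeniusMaps_mul_obstruction`). Yet in each degree e > 0 there is a map sending z s_2 to s_{p^e},
and (xz)^(p^e - 1) s_{p^e} = s_1 ≠ 0. Finitely many generators have bounded degree, so they cannot
produce these maps (`not_frobeniusAlgebraFG`).

For U', the monomial x^p y^(p-1) lies in J_p, while I^[p] ⊆ (y^p). Hence the annihilator lies in (y)
and U' misses V(y). This set contains 𝔪, giving U' ⊆ U, and also the prime (y) ≠ 𝔪, giving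
strictness. -/

namespace FrobeniusLocus

/-! ### Basic properties of injective hulls of residue fields -/

section HullProperties

variable {A : Type u} [CommRing A] {E : Type u} [AddCommGroup E] [Module A E]

/-- In an injective module `E`, the equation `a t = s` has a solution `t` killed by the ideal `K`
as soon as `(K : a)` kills `s`. -/
theorem exists_smul_eq_of_injective (hE : Module.Injective A E) (K : Ideal A) (a : A) (s : E)
    (h : ∀ b : A, b * a ∈ K → b • s = 0) : ∃ t : E, a • t = s ∧ ∀ c ∈ K, c • t = 0 := by
  -- Multiplication by a embeds A/(K : a) in A/K. Extending 1 ↦ s along this embedding and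
  -- evaluating at 1 gives t.
  let f : A →ₗ[A] A ⧸ K := K.mkQ ∘ₗ LinearMap.mulRight A a
  have hf : ∀ b, f b = 0 ↔ b * a ∈ K := fun b =>
    Submodule.Quotient.mk_eq_zero K
  let i : (A ⧸ LinearMap.ker f) →ₗ[A] A ⧸ K := (LinearMap.ker f).liftQ f le_rfl
  have hi : Function.Injective i := by
    rw [← LinearMap.ker_eq_bot]
    exact Submodule.ker_liftQ_eq_bot _ _ _ le_rfl
  let g : (A ⧸ LinearMap.ker f) →ₗ[A] E :=
    (LinearMap.ker f).liftQ (LinearMap.toSpanSingleton A E s) fun b hb => by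
      simpa using h b ((hf b).1 hb)
  obtain ⟨φ, hφ⟩ := hE.out i hi g
  refine ⟨φ (K.mkQ 1), ?_, fun c hc => ?_⟩
  · have h1 := hφ ((LinearMap.ker f).mkQ 1)
    simp only [i, g, Submodule.mkQ_apply, Submodule.liftQ_apply,
      LinearMap.toSpanSingleton_apply, one_smul] at h1
    rw [← h1, ← map_smul, ← map_smul]
    congr 1
    simp [f]
  · rw [← map_smul, ← map_smul]
    have : K.mkQ (c • 1) = 0 := by
      simpa [Ideal.Quotient.eq_zero_iff_mem] using hc
    rw [this, map_zero]

variable [IsLocalRing A] {ι : IsLocalRing.ResidueField A →ₗ[A] E}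

/-- The socle of the hull is no larger than the residue field: if 𝔪 kills v ≠ 0, essentiality gives
a nonzero multiple a v in the image of ι, and a must be a unit since otherwise a v = 0. -/
theorem IsInjectiveHull.exists_socle_generator (h : IsInjectiveHull ι) :
    ∃ s : E, s ≠ 0 ∧ (∀ a ∈ IsLocalRing.maximalIdeal A, a • s = 0) ∧
      ∀ v : E, (∀ a ∈ IsLocalRing.maximalIdeal A, a • v = 0) → ∃ r : A, v = r • s := by
  have hr : ∀ r : A, ι (IsLocalRing.residue A r) = r • ι 1 := fun r => by
    rw [← map_smul, Algebra.smul_def, mul_one]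
    rfl
  refine ⟨ι 1, fun h0 => one_ne_zero (h.injective (h0.trans (map_zero ι).symm)), ?_, ?_⟩
  · intro a ha
    rw [← hr, (IsLocalRing.residue_eq_zero_iff a).2 ha, map_zero]
  · intro v hv
    by_cases hv0 : v = 0
    · exact ⟨0, by simp [hv0]⟩
    obtain ⟨w, ⟨hw1, ⟨c, hc⟩⟩, hw0⟩ := (Submodule.ne_bot_iff _).1
      (h.essential (Submodule.span A {v}) (by simpa using hv0))
    obtain ⟨a, rfl⟩ := Submodule.mem_span_singleton.1 hw1
    obtain ⟨r, rfl⟩ := IsLocalRing.residue_surjective c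
    have ha : IsUnit a := by
      by_contra hna
      exact hw0 (hv a ((IsLocalRing.mem_maximalIdeal a).2 hna))
    obtain ⟨b, hb⟩ := ha.exists_left_inv
    refine ⟨b * r, ?_⟩
    rw [mul_smul, ← hr, hc, smul_smul, hb, one_smul]

/-- Artin–Rees for N = Av and its part L inside the residue field gives 𝔪^(k+1) N ∩ L ⊆ 𝔪L = 0, and
essentiality then forces 𝔪^(k+1) N = 0. -/
theorem IsInjectiveHull.exists_pow_smul_eq_zero [IsNoetherianRing A] (h : IsInjectiveHull ι)
    (v : E) : ∃ n : ℕ, ∀ a ∈ IsLocalRing.maximalIdeal A ^ n, a • v = 0 := by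
  set m := IsLocalRing.maximalIdeal A
  set N := Submodule.span A {v}
  let L : Submodule A N := (LinearMap.range ι).comap N.subtype
  have hmL : m • L ≤ ⊥ := by
    rw [Submodule.smul_le]
    rintro a ha ⟨n, hn⟩ ⟨c, hc⟩
    obtain ⟨r, rfl⟩ := IsLocalRing.residue_surjective c
    rw [Submodule.mem_bot]
    refine Subtype.ext ?_
    change a • n = 0
    rw [show n = _ from hc.symm, ← map_smul, Algebra.smul_def]
    have : algebraMap A (IsLocalRing.ResidueField A) a = 0 :=
      (IsLocalRing.residue_eq_zero_iff a).2 ha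
    rw [this, zero_mul, map_zero]
  have : Module.Finite A N := Module.Finite.iff_fg.2 (Submodule.fg_span_singleton v)
  obtain ⟨k, hk⟩ := m.exists_pow_inf_eq_pow_smul L
  have h1 := hk (k + 1) (by omega)
  have h2 : m ^ (k + 1) • (⊤ : Submodule A N) ⊓ L = ⊥ := by
    rw [h1, Nat.add_sub_cancel_left, pow_one, eq_bot_iff]
    exact (smul_mono_right m inf_le_right).trans hmL
  have h3 : (m ^ (k + 1) • (⊤ : Submodule A N)).map N.subtype = ⊥ := by
    by_contra hne
    refine h.essential _ hne (eq_bot_iff.2 ?_)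
    rintro _ ⟨⟨n, hn, rfl⟩, hr⟩
    have : n ∈ m ^ (k + 1) • (⊤ : Submodule A N) ⊓ L := ⟨hn, hr⟩
    rw [h2, Submodule.mem_bot] at this
    simp [this]
  refine ⟨k + 1, fun a ha => ?_⟩
  have h4 : a • (⟨v, Submodule.mem_span_singleton_self v⟩ : N) ∈ m ^ (k + 1) • (⊤ : Submodule A N) :=
    Submodule.smul_mem_smul ha trivial
  have h5 := Submodule.mem_map_of_mem (f := N.subtype) h4
  rw [h3, Submodule.mem_bot] at h5
  exact h5

end HullProperties

/-! ### Semilinear maps on a directed union of cyclic modules -/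

section DirectedUnion

variable {A : Type*} [CommRing A] {M N : Type*} [AddCommGroup M] [Module A M] [AddCommGroup N]
  [Module A N] {s : ℕ → M} {d : A}

theorem pow_smul_of_smul_succ (hs : ∀ n, d • s (n + 1) = s n) (n j : ℕ) :
    d ^ j • s (n + j) = s n := by
  induction j with
  | zero => simp
  | succ j ih => rw [pow_succ, mul_smul, ← add_assoc, hs, ih]

/-- If `M` is the union of the cyclic submodules generated by the `s n`, where `s n = d s (n + 1)`,
then a compatible family of images of the `s n` determines a semilinear map. -/
theorem exists_semilinear_of_directed (σ : A →+* A) {w : ℕ → N}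
    (hs : ∀ n, d • s (n + 1) = s n) (hw : ∀ n, σ d • w (n + 1) = w n)
    (hgen : ∀ v, ∃ (r : A) (n : ℕ), v = r • s n)
    (hker : ∀ (n : ℕ) (r : A), r • s n = 0 → σ r • w n = 0) :
    ∃ φ : M →+ N, ∀ (r : A) (n : ℕ), φ (r • s n) = σ r • w n := by
  have hs' := pow_smul_of_smul_succ hs
  have hw' := pow_smul_of_smul_succ hw
  -- Both representations are lifted to the common level n + m, where `hker` compares them.
  have key : ∀ (r r' : A) (n m : ℕ), r • s n = r' • s m → σ r • w n = σ r' • w m := by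
    intro r r' n m he
    have h1 := hker (n + m) (r * d ^ m - r' * d ^ n) (by
      rw [sub_smul, mul_smul, mul_smul, hs', add_comm n m, hs', he, sub_self])
    rwa [map_sub, map_mul, map_mul, map_pow, map_pow, sub_smul, mul_smul, mul_smul, hw',
      add_comm n m, hw', sub_eq_zero] at h1
  choose r n hrn using hgen
  have hφ : ∀ (a : A) (j : ℕ), σ (r (a • s j)) • w (n (a • s j)) = σ a • w j :=
    fun a j => key _ _ _ _ (hrn _).symm
  refine ⟨AddMonoidHom.mk' (fun v => σ (r v) • w (n v)) fun v v' => ?_, hφ⟩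
  have h2 : v + v' = (r v * d ^ n v' + r v' * d ^ n v) • s (n v + n v') := by
    rw [add_smul, mul_smul, mul_smul, hs', add_comm (n v) (n v'), hs', ← hrn, ← hrn]
  change σ (r (v + v')) • w (n (v + v')) = σ (r v) • w (n v) + σ (r v') • w (n v')
  rw [h2, hφ, map_add, map_mul, map_mul, map_pow, map_pow, add_smul, mul_smul, mul_smul, hw',
    add_comm (n v) (n v'), hw']

end DirectedUnion

/-! ### Finite generation over local domains with principal maximal ideal -/

section FinitelyGenerated

variable {p : ℕ} {A : Type u} [CommRing A] {M : Type u} [AddCommGroup M] [Module A M]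

theorem mem_frobeniusMaps {e : ℕ} {φ : AddMonoid.End M} :
    φ ∈ frobeniusMaps p A M e ↔ ∀ (r : A) (x : M), φ (r • x) = r ^ p ^ e • φ x :=
  Iff.rfl

/-- If every element of `𝓕ᵉ(M)` is the composition of a linear map with the `e`-th power of a fixed
`Φ ∈ 𝓕¹(M)`, then `Φ` generates the Frobenius algebra over its degree zero part. -/
theorem frobeniusAlgebraFG_of_forall_eq_mul_pow (Φ : AddMonoid.End M)
    (hΦ : Φ ∈ frobeniusMaps p A M 1)
    (h : ∀ (e : ℕ), ∀ φ ∈ frobeniusMaps p A M e, ∃ ψ ∈ frobeniusMaps p A M 0, φ = ψ * Φ ^ e) :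
    FrobeniusAlgebraFG p A M := by
  classical
  let g : FrobeniusAlgebra p A M := DirectSum.of (fun e : ℕ => frobeniusMaps p A M e) 1 ⟨Φ, hΦ⟩
  refine ⟨{g}, eq_top_iff.2 fun f _ => ?_⟩
  induction f using DirectSum.induction_on with
  | zero => exact zero_mem _
  | add f f' hf hf' => exact add_mem (hf trivial) (hf' trivial)
  | of e φ =>
    obtain ⟨ψ, hψ, he⟩ := h e φ φ.2
    have hg : DirectSum.of (fun e : ℕ => frobeniusMaps p A M e) e φ =
        DirectSum.of (fun e : ℕ => frobeniusMaps p A M e) 0 ⟨ψ, hψ⟩ * g ^ e := by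
      rw [DirectSum.ofPow, DirectSum.of_mul_of]
      refine DirectSum.of_eq_of_gradedMonoid_eq (Sigma.subtype_ext ?_ ?_)
      · change e = 0 + e * 1
        omega
      · exact he
    rw [hg]
    refine Subring.mul_mem _ ?_ (Subring.pow_mem _ ?_ e)
    · exact Subring.subset_closure (Set.mem_union_left _ ⟨_, rfl⟩)
    · exact Subring.subset_closure
        (Set.mem_union_right _ (Finset.mem_coe.2 (Finset.mem_singleton_self g)))

/-- `hfrob` makes Φ : r s_n ↦ r^p s_{pn} well defined. `hroot` makes ψ : r s_{qn} ↦ r φ(s_n) well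
defined for φ of degree e and q = p^e, and then φ = ψ Φ^e. -/
theorem frobeniusAlgebraFG_of_directed [Fact p.Prime] [CharP A p] (s : ℕ → M) (d : A)
    (hs : ∀ n, d • s (n + 1) = s n) (hgen : ∀ v, ∃ (r : A) (n : ℕ), v = r • s n)
    (hfrob : ∀ (n : ℕ) (r : A), r • s n = 0 → r ^ p • s (p * n) = 0)
    (hroot : ∀ (n q : ℕ) (r : A), 0 < q → r • s (q * n) = 0 → ∃ a c : A, a • s n = 0 ∧ r = c * a ^ q) :
    FrobeniusAlgebraFG p A M := by
  have hp : 0 < p := (Fact.out : p.Prime).pos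
  have hs' := pow_smul_of_smul_succ hs
  obtain ⟨Φ, hΦ⟩ : ∃ Φ : AddMonoid.End M, ∀ (r : A) (n : ℕ), Φ (r • s n) = r ^ p • s (p * n) :=
    exists_semilinear_of_directed (frobenius A p) (w := fun n => s (p * n)) hs
      (fun n => hs' (p * n) p) hgen hfrob
  have hΦmem : Φ ∈ frobeniusMaps p A M 1 := by
    rw [mem_frobeniusMaps]
    intro r v
    obtain ⟨a, n, rfl⟩ := hgen v
    rw [smul_smul, hΦ, hΦ, pow_one, mul_pow, mul_smul]
  have hpow : ∀ (e : ℕ) (r : A) (n : ℕ),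
      (Φ ^ e) (r • s n) = r ^ p ^ e • s (p ^ e * n) := by
    intro e
    induction e with
    | zero => simp
    | succ e ih =>
      intro r n
      rw [pow_succ', AddMonoid.End.coe_mul, Function.comp_apply, ih, hΦ, ← pow_mul, ← pow_succ, ← mul_assoc,
        ← pow_succ']
  refine frobeniusAlgebraFG_of_forall_eq_mul_pow Φ hΦmem fun e φ hφ => ?_
  rw [mem_frobeniusMaps] at hφ
  have hq : 0 < p ^ e := pow_pos hp e
  -- The levels divisible by p^e are cofinal, so ψ need only be prescribed on them.
  have hgen' : ∀ v, ∃ (r : A) (n : ℕ), v = r • s (p ^ e * n) := fun v => by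
    obtain ⟨r, n, rfl⟩ := hgen v
    obtain ⟨j, hj⟩ := Nat.exists_eq_add_of_le (Nat.le_mul_of_pos_left n hq)
    exact ⟨r * d ^ j, n, by rw [mul_smul, hj, hs']⟩
  obtain ⟨ψ, hψ⟩ : ∃ ψ : AddMonoid.End M, ∀ (r : A) (n : ℕ), ψ (r • s (p ^ e * n)) = r • φ (s n) :=
    exists_semilinear_of_directed (RingHom.id A) (s := fun n => s (p ^ e * n))
      (d := d ^ p ^ e) (w := fun n => φ (s n)) (fun n => hs' (p ^ e * n) (p ^ e))
      (fun n => by rw [RingHom.id_apply, ← hφ, hs]) hgen'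
      (fun n r hr => by
        obtain ⟨a, c, ha, rfl⟩ := hroot n _ r hq hr
        rw [RingHom.id_apply, mul_smul, ← hφ, ha, map_zero, smul_zero])
  refine ⟨ψ, ?_, ?_⟩
  · rw [mem_frobeniusMaps]
    intro r v
    obtain ⟨a, n, rfl⟩ := hgen' v
    rw [smul_smul, hψ, hψ, pow_zero, pow_one, mul_smul]
  · refine DFunLike.ext _ _ fun v => ?_
    obtain ⟨r, n, rfl⟩ := hgen v
    rw [AddMonoid.End.coe_mul, Function.comp_apply, hpow, hψ, hφ]

/-- Over a noetherian local domain whose maximal ideal is principal, the Frobenius algebra of the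
injective hull of the residue field is finitely generated. -/
theorem frobeniusAlgebraFG_of_isPrincipal [Fact p.Prime] [CharP A p] [IsDomain A] [IsLocalRing A]
    [IsNoetherianRing A] (hA : (IsLocalRing.maximalIdeal A).IsPrincipal)
    {ι : IsLocalRing.ResidueField A →ₗ[A] M} (hι : IsInjectiveHull ι) :
    FrobeniusAlgebraFG p A M := by
  have hp : 0 < p := (Fact.out : p.Prime).pos
  obtain ⟨t, ht⟩ := hA
  rw [← Ideal.span] at ht
  have htm : t ∈ IsLocalRing.maximalIdeal A := ht ▸ Ideal.mem_span_singleton_self t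
  have hdvd : ∀ a, ¬ IsUnit a → t ∣ a := fun a ha => by
    rw [← Ideal.mem_span_singleton, ← ht]
    exact (IsLocalRing.mem_maximalIdeal a).2 ha
  obtain ⟨s₁, hs₁, hms₁, hsoc⟩ := hι.exists_socle_generator
  have hsoc' : ∀ v, t • v = 0 → ∃ r : A, v = r • s₁ := fun v hv => hsoc v fun a ha => by
    rw [ht, Ideal.mem_span_singleton'] at ha
    obtain ⟨b, rfl⟩ := ha
    rw [mul_smul, hv, smul_zero]
  -- If t = 0 then A is a field and E = A s₁, so the constant sequence with d = 1 serves.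
  by_cases ht0 : t = 0
  · have hunit : ∀ (r : A) , r • s₁ = 0 → r = 0 := fun r hr => by
      by_contra hne
      have : IsUnit r := by
        by_contra hnu
        exact hne (by simpa [ht0] using hdvd r hnu)
      exact hs₁ ((this.smul_eq_zero).1 hr)
    refine frobeniusAlgebraFG_of_directed (fun _ => s₁) 1 (fun _ => one_smul _ _)
      (fun v => ?_) (fun _ r hr => ?_) (fun _ q r hq hr => ⟨0, 0, zero_smul _ _, ?_⟩)
    · obtain ⟨r, hr⟩ := hsoc' v (by rw [ht0, zero_smul])
      exact ⟨r, 0, hr⟩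
    · rw [hunit r hr, zero_pow hp.ne', zero_smul]
    · rw [hunit r hr, zero_mul]
  have hdiv : ∀ s : M, ∃ v : M, t • v = s := fun s => by
    obtain ⟨v, hv, -⟩ := exists_smul_eq_of_injective hι.injective_module ⊥ t s fun b hb => by
      rw [(mul_eq_zero.1 ((Submodule.mem_bot A).1 hb)).resolve_right ht0, zero_smul]
    exact ⟨v, hv⟩
  choose D hD using hdiv
  -- The value s 0 = 0 keeps Ann(s_n) = (tⁿ) valid at n = 0 and puts the socle generator at n = 1.
  let s : ℕ → M := fun n => n.casesOn 0 fun m => D^[m] s₁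
  have hs : ∀ n, t • s (n + 1) = s n := by
    rintro (_ | n)
    · exact hms₁ t htm
    · change t • D^[n + 1] s₁ = D^[n] s₁
      rw [Function.iterate_succ_apply', hD]
  have hs' := pow_smul_of_smul_succ hs
  have hkill : ∀ n, t ^ n • s n = 0 := fun n => by simpa [s] using hs' 0 n
  have hgen : ∀ (n : ℕ) (v : M), t ^ n • v = 0 → ∃ r : A, v = r • s n := by
    intro n
    induction n with
    | zero => exact fun v hv => ⟨0, by simpa using hv⟩
    | succ n ih =>
      intro v hv
      obtain ⟨r, hr⟩ := ih (t • v) (by rwa [smul_smul, ← pow_succ])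
      obtain ⟨r', hr'⟩ := hsoc' (v - r • s (n + 1)) (by
        rw [smul_sub, hr, smul_comm, hs, sub_self])
      refine ⟨r + r' * t ^ n, ?_⟩
      have h1 : t ^ n • s (n + 1) = s₁ := by rw [add_comm]; exact hs' 1 n
      rw [add_smul, mul_smul, h1, ← hr', add_sub_cancel]
  have hann : ∀ (n : ℕ) (r : A), r • s n = 0 → t ^ n ∣ r := by
    intro n
    induction n with
    | zero => simp
    | succ n ih =>
      intro r hr
      obtain ⟨c, rfl⟩ := ih r (by rw [← hs n, smul_comm, hr, smul_zero])
      rw [pow_succ]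
      refine mul_dvd_mul_left _ (hdvd c fun hc => hs₁ ?_)
      have h1 : t ^ n • s (n + 1) = s₁ := by rw [add_comm]; exact hs' 1 n
      rw [mul_comm, mul_smul, h1] at hr
      exact (hc.smul_eq_zero).1 hr
  refine frobeniusAlgebraFG_of_directed s t hs (fun v => ?_) (fun n r hr => ?_)
    (fun n q r hq hr => ?_)
  · obtain ⟨n, hn⟩ := hι.exists_pow_smul_eq_zero v
    obtain ⟨r, hr⟩ := hgen n v (hn _ (Ideal.pow_mem_pow htm n))
    exact ⟨r, n, hr⟩
  · obtain ⟨c, rfl⟩ := hann n r hr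
    rw [mul_pow, mul_comm, mul_smul, ← pow_mul, mul_comm n p, hkill, smul_zero]
  · obtain ⟨c, rfl⟩ := hann _ r hr
    exact ⟨t ^ n, c, hkill n, by rw [← pow_mul, mul_comm n q, mul_comm]⟩

end FinitelyGenerated

/-! ### A local ring whose Frobenius algebra is not finitely generated -/

section RegularModulo

variable {A : Type*} [CommRing A] {x y z : A}

theorem exists_of_pow_mul_eq (hz : ∀ c a, z * c = y * a → ∃ b, c = y * b) (n : ℕ) :
    ∀ c a, z ^ n * c = y * a → ∃ b, c = y * b := by
  induction n with
  | zero => exact fun c a h => ⟨a, by simpa using h⟩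
  | succ n ih =>
    intro c a h
    obtain ⟨b, hb⟩ := ih (z * c) a (by rw [← h]; ring)
    exact hz c b hb

/-- If `x` is regular modulo `(z, y)` and `z` is regular modulo `y`, then `x` is regular modulo
`(z ^ n, y)`. -/
theorem exists_of_mul_eq_pow (hz : ∀ c a, z * c = y * a → ∃ b, c = y * b)
    (hx : ∀ c a b, x * c = z * a + y * b → ∃ a' b', c = z * a' + y * b') (n : ℕ) :
    ∀ c a b, x * c = z ^ n * a + y * b → ∃ a' b', c = z ^ n * a' + y * b' := by
  induction n with
  | zero => exact fun c a b _ => ⟨c, 0, by simp⟩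
  | succ n ih =>
    intro c a b h
    obtain ⟨a', b', rfl⟩ := ih c (z * a) b (by rw [h]; ring)
    obtain ⟨b₁, hb₁⟩ := exists_of_pow_mul_eq hz n (x * a' - z * a) (b - x * b')
      (by linear_combination h)
    obtain ⟨a₂, b₂, rfl⟩ := hx a' a b₁ (by linear_combination hb₁)
    exact ⟨a₂, z ^ n * b₂ + b', by ring⟩

/-- First x is cancelled modulo (z^(n+1), y), then z modulo (xⁿ, y). This is the colon condition
that allows s_n to be divided by xz when the dual system is built. -/
theorem mem_span_pow_of_mul_mem (hxy : ∀ c a, x * c = y * a → ∃ b, c = y * b)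
    (hzy : ∀ c a, z * c = y * a → ∃ b, c = y * b)
    (hx : ∀ c a b, x * c = z * a + y * b → ∃ a' b', c = z * a' + y * b')
    (hz : ∀ c a b, z * c = x * a + y * b → ∃ a' b', c = x * a' + y * b') (n : ℕ) (b : A)
    (h : b * (x * z) ∈ Ideal.span {x ^ (n + 1), z ^ (n + 1), y}) :
    b ∈ Ideal.span {x ^ n, z ^ n, y} := by
  obtain ⟨α, β, γ, h⟩ := Submodule.mem_span_triple.1 h
  simp only [smul_eq_mul] at h
  obtain ⟨β', γ', h1⟩ := exists_of_mul_eq_pow hzy hx (n + 1) (b * z - α * x ^ n) β γ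
    (by linear_combination -h)
  obtain ⟨α', γ'', h2⟩ := exists_of_mul_eq_pow hxy hz n (b - z ^ n * β') α γ'
    (by linear_combination h1)
  exact Submodule.mem_span_triple.2 ⟨α', β', γ'', by simp only [smul_eq_mul]; linear_combination -h2⟩

end RegularModulo

/-! ### Inverse polynomials inside the injective hull -/

section DualSystem

variable {A : Type u} [CommRing A] {E : Type u} [AddCommGroup E] [Module A E] [IsLocalRing A]
  {ι : IsLocalRing.ResidueField A →ₗ[A] E} {x y z : A}

/-- If `x, z` is a regular sequence modulo `y` in either order and `𝔪 = (x, z, y)`, the submodule of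
the injective hull of the residue field killed by `y` is the union of cyclic submodules
`A s n` with `s n = xz s (n + 1)` and `Ann (s n) = (xⁿ, zⁿ, y)`. -/
theorem IsInjectiveHull.exists_dual_system [IsNoetherianRing A] (hι : IsInjectiveHull ι)
    (hm : IsLocalRing.maximalIdeal A = Ideal.span {x, z, y})
    (hxy : ∀ c a, x * c = y * a → ∃ b, c = y * b)
    (hzy : ∀ c a, z * c = y * a → ∃ b, c = y * b)
    (hx : ∀ c a b, x * c = z * a + y * b → ∃ a' b', c = z * a' + y * b')
    (hz : ∀ c a b, z * c = x * a + y * b → ∃ a' b', c = x * a' + y * b') :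
    ∃ s : ℕ → E, (∀ n, (x * z) • s (n + 1) = s n) ∧ s 1 ≠ 0 ∧
      (∀ n, ∀ r ∈ Ideal.span {x ^ n, z ^ n, y}, r • s n = 0) ∧
      (∀ v, y • v = 0 → ∃ (r : A) (n : ℕ), v = r • s n) ∧
      (∀ n r, r • s n = 0 → r ∈ Ideal.span {x ^ n, z ^ n, y}) := by
  obtain ⟨s₁, hs₁, hms₁, hsoc⟩ := hι.exists_socle_generator
  let K : ℕ → Ideal A := fun n => Ideal.span {x ^ n, z ^ n, y}
  have hxK : ∀ n, x ^ n ∈ K n := fun n => Ideal.subset_span (by simp)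
  have hzK : ∀ n, z ^ n ∈ K n := fun n => Ideal.subset_span (by simp)
  have hyK : ∀ n, y ∈ K n := fun n => Ideal.subset_span (by simp)
  have hK1 : K 1 = IsLocalRing.maximalIdeal A := by simp [K, hm]
  have hstep : ∀ (n : ℕ) (v : {v : E // ∀ c ∈ K (n + 1), c • v = 0}),
      ∃ w : {v : E // ∀ c ∈ K (n + 2), c • v = 0}, (x * z) • (w : E) = v := by
    rintro n ⟨v, hv⟩
    obtain ⟨w, hw, hw'⟩ := exists_smul_eq_of_injective hι.injective_module (K (n + 2)) (x * z) v
      fun b hb => hv b (mem_span_pow_of_mul_mem hxy hzy hx hz (n + 1) b hb)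
    exact ⟨⟨w, hw'⟩, hw⟩
  choose step hstep using hstep
  let t : (n : ℕ) → {v : E // ∀ c ∈ K (n + 1), c • v = 0} := fun n =>
    Nat.rec ⟨s₁, fun c hc => hms₁ c (hK1 ▸ hc)⟩ (fun n v => step n v) n
  let s : ℕ → E := fun n => n.casesOn 0 fun m => (t m).1
  have hs1 : s 1 = s₁ := rfl
  have hs : ∀ n, (x * z) • s (n + 1) = s n := by
    rintro (_ | n)
    · exact hms₁ _ (hm ▸ Ideal.mul_mem_right _ _ (Ideal.subset_span (by simp)))
    · exact hstep n (t n)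
  have hsK : ∀ n, ∀ r ∈ K n, r • s n = 0 := by
    rintro (_ | n) r hr
    · exact smul_zero r
    · exact (t n).2 r hr
  have hs' := pow_smul_of_smul_succ hs
  -- Since s_n stands for x⁻ⁿz⁻ⁿ, this element stands for x⁻ⁱz⁻ʲ. Separate exponents allow
  -- inductions on i and j in which each step reduces to the socle or to the case i = 1.
  let e : ℕ → ℕ → E := fun i j => (x ^ j * z ^ i) • s (i + j)
  have hex : ∀ i j, x • e (i + 1) j = e i j := fun i j => by
    simp only [e]
    rw [← hs (i + j), smul_smul, smul_smul, add_right_comm]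
    congr 1
    ring
  have hez : ∀ i j, z • e i (j + 1) = e i j := fun i j => by
    simp only [e]
    rw [← hs (i + j), smul_smul, smul_smul, ← add_assoc]
    congr 1
    ring
  have hexp : ∀ i j n, x ^ n • e (i + n) j = e i j := fun i j =>
    pow_smul_of_smul_succ (s := fun i => e i j) (fun i => hex i j) i
  have hezp : ∀ i j n, z ^ n • e i (j + n) = e i j := fun i =>
    pow_smul_of_smul_succ (s := fun j => e i j) (fun j => hez i j)
  have hey : ∀ i j, y • e i j = 0 := fun i j => by
    simp only [e]
    rw [smul_comm, hsK _ y (hyK _), smul_zero]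
  have he0 : ∀ j, e 0 j = 0 := fun j => by
    simp only [e, pow_zero, mul_one, zero_add]
    exact hsK _ _ (hxK j)
  have he0' : ∀ i, e i 0 = 0 := fun i => by
    simp only [e, pow_zero, one_mul, add_zero]
    exact hsK _ _ (hzK i)
  have hee : ∀ n, e n n = s n := fun n => by
    simp only [e]
    rw [← mul_pow, hs']
  have he11 : e 1 1 = s₁ := (hee 1).trans hs1
  clear_value e
  have hsoc' : ∀ v, x • v = 0 → y • v = 0 → z • v = 0 → ∃ r : A, v = r • s₁ :=
    fun v h1 h2 h3 => hsoc v fun a ha => by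
      obtain ⟨α, β, γ, rfl⟩ := Submodule.mem_span_triple.1 (hm ▸ ha)
      simp only [add_smul, smul_assoc, h1, h2, h3, smul_zero, add_zero]
  have hgen1 : ∀ (j : ℕ) (v : E), y • v = 0 → x • v = 0 → z ^ j • v = 0 →
      ∃ r : A, v = r • e 1 j := by
    intro j
    induction j with
    | zero => exact fun v _ _ hv => ⟨0, by simpa using hv⟩
    | succ j ih =>
      intro v hyv hxv hv
      obtain ⟨r, hr⟩ := ih (z • v) (by rw [smul_comm, hyv, smul_zero])
        (by rw [smul_comm, hxv, smul_zero]) (by rwa [smul_smul, ← pow_succ])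
      obtain ⟨r', hr'⟩ := hsoc' (v - r • e 1 (j + 1))
        (by rw [smul_sub, hxv, smul_comm, hex, he0, smul_zero, sub_zero])
        (by rw [smul_sub, hyv, smul_comm, hey, smul_zero, sub_zero])
        (by rw [smul_sub, hr, smul_comm, hez, sub_self])
      refine ⟨r + r' * z ^ j, ?_⟩
      rw [add_smul, mul_smul, add_comm j 1, hezp, he11, ← hr', add_comm 1 j, add_sub_cancel]
  have hgen : ∀ (i j : ℕ) (v : E), y • v = 0 → x ^ i • v = 0 → z ^ j • v = 0 →
      ∃ r : A, v = r • e i j := by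
    intro i j
    induction i with
    | zero => exact fun v _ hv _ => ⟨0, by simpa using hv⟩
    | succ i ih =>
      intro v hyv hxv hzv
      obtain ⟨r, hr⟩ := ih (x • v) (by rw [smul_comm, hyv, smul_zero])
        (by rwa [smul_smul, ← pow_succ]) (by rw [smul_comm, hzv, smul_zero])
      obtain ⟨r', hr'⟩ := hgen1 j (v - r • e (i + 1) j)
        (by rw [smul_sub, hyv, smul_comm, hey, smul_zero, sub_zero])
        (by rw [smul_sub, hr, smul_comm, hex, sub_self])
        (by
          have := hezp (i + 1) 0 j
          rw [zero_add, he0'] at this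
          rw [smul_sub, hzv, smul_comm, this, smul_zero, sub_zero])
      refine ⟨r + r' * x ^ i, ?_⟩
      rw [add_smul, mul_smul, add_comm i 1, hexp, ← hr', add_comm 1 i, add_sub_cancel]
  have hann1 : ∀ (j : ℕ) (r : A), r • e 1 j = 0 → r ∈ Ideal.span {x, z ^ j, y} := by
    intro j
    induction j with
    | zero =>
      intro r _
      rw [(Ideal.eq_top_iff_one _).2 (Ideal.subset_span (by simp))]
      trivial
    | succ j ih =>
      intro r hr
      obtain ⟨α, β, γ, rfl⟩ := Submodule.mem_span_triple.1
        (ih r (by rw [← hez, smul_comm, hr, smul_zero]))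
      have hxe : x • e 1 (j + 1) = 0 := by rw [hex, he0]
      have hze : z ^ j • e 1 (j + 1) = s₁ := by rw [add_comm, hezp, he11]
      simp only [smul_eq_mul, add_smul, mul_smul, hxe, hey, hze, smul_zero, zero_add,
        add_zero] at hr
      have hβ : β ∈ IsLocalRing.maximalIdeal A := by
        by_contra hβ
        rw [IsLocalRing.mem_maximalIdeal, mem_nonunits_iff, not_not] at hβ
        exact hs₁ (hβ.smul_eq_zero.1 hr)
      obtain ⟨a, b, c, rfl⟩ := Submodule.mem_span_triple.1 (hm ▸ hβ)
      refine Submodule.mem_span_triple.2 ⟨α + a * z ^ j, b, γ + c * z ^ j, ?_⟩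
      simp only [smul_eq_mul]
      ring
  have hann : ∀ (i j : ℕ) (r : A), r • e i j = 0 → r ∈ Ideal.span {x ^ i, z ^ j, y} := by
    intro i j
    induction i with
    | zero =>
      intro r _
      rw [(Ideal.eq_top_iff_one _).2 (Ideal.subset_span (by simp))]
      trivial
    | succ i ih =>
      intro r hr
      obtain ⟨α, β, γ, rfl⟩ := Submodule.mem_span_triple.1
        (ih r (by rw [← hex, smul_comm, hr, smul_zero]))
      have hxe : x ^ i • e (i + 1) j = e 1 j := by rw [add_comm, hexp]
      have hze : z ^ j • e (i + 1) j = 0 := by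
        have := hezp (i + 1) 0 j
        rwa [zero_add, he0'] at this
      simp only [smul_eq_mul, add_smul, mul_smul, hxe, hey, hze, smul_zero, add_zero] at hr
      obtain ⟨a, b, c, rfl⟩ := Submodule.mem_span_triple.1 (hann1 j α hr)
      refine Submodule.mem_span_triple.2 ⟨a, β + b * x ^ i, γ + c * x ^ i, ?_⟩
      simp only [smul_eq_mul]
      ring
  refine ⟨s, hs, hs1 ▸ hs₁, hsK, fun v hv => ?_, fun n r hr => hann n n r (by rwa [hee])⟩
  obtain ⟨n, hn⟩ := hι.exists_pow_smul_eq_zero v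
  obtain ⟨r, hr⟩ := hgen n n v hv
    (hn _ (Ideal.pow_mem_pow (hm ▸ Ideal.subset_span (by simp)) n))
    (hn _ (Ideal.pow_mem_pow (hm ▸ Ideal.subset_span (by simp)) n))
  exact ⟨r, n, by rw [hr, hee]⟩

end DualSystem

/-! ### The obstruction to finite generation -/

section NotFinitelyGenerated

variable {p : ℕ} {A : Type u} [CommRing A] {E : Type u} [AddCommGroup E] [Module A E] {x y z : A}

/-- Frobenius maps preserve the elements killed by `x`, `y`, `z`, provided that these are divisible by
`x` and `y`. -/
theorem frobeniusMaps_socle [Fact p.Prime] (hxy0 : x * y = 0) (hyz0 : y * z = 0)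
    (hdiv : ∀ v : E, x • v = 0 → y • v = 0 → z • v = 0 → (∃ w, x • w = v) ∧ ∃ w, y • w = v)
    {e : ℕ} {φ : AddMonoid.End E} (hφ : φ ∈ frobeniusMaps p A E e) {v : E} (hx : x • v = 0)
    (hy : y • v = 0) (hz : z • v = 0) : x • φ v = 0 ∧ y • φ v = 0 ∧ z • φ v = 0 := by
  rw [mem_frobeniusMaps] at hφ
  obtain ⟨⟨w, hw⟩, w', hw'⟩ := hdiv v hx hy hz
  obtain ⟨q, hq⟩ := Nat.exists_eq_succ_of_ne_zero (pow_pos (Fact.out : p.Prime).pos e).ne'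
  refine ⟨?_, ?_, ?_⟩
  · rw [← hw', hφ, hq, pow_succ', smul_smul, ← mul_assoc, hxy0, zero_mul, zero_smul]
  · rw [← hw, hφ, hq, pow_succ', smul_smul, ← mul_assoc, mul_comm y, hxy0, zero_mul, zero_smul]
  · rw [← hw', hφ, hq, pow_succ', smul_smul, ← mul_assoc, mul_comm z, hyz0, zero_mul, zero_smul]

/-- A composition of two Frobenius maps of positive degrees `a` and `b` sends elements killed by `z` and
`x ^ 2` to elements killed by `(xz) ^ (p ^ (a + b) - 1)`. -/
theorem frobeniusMaps_mul_obstruction [Fact p.Prime] (hxy0 : x * y = 0) (hyz0 : y * z = 0)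
    (hdiv : ∀ v : E, x • v = 0 → y • v = 0 → z • v = 0 → (∃ w, x • w = v) ∧ ∃ w, y • w = v)
    {a b : ℕ} (ha : a ≠ 0) (hb : b ≠ 0) {φ ψ : AddMonoid.End E} (hφ : φ ∈ frobeniusMaps p A E a)
    (hψ : ψ ∈ frobeniusMaps p A E b) {v : E} (hzv : z • v = 0) (hxv : x ^ 2 • v = 0) :
    (x * z) ^ (p ^ (a + b) - 1) • φ (ψ v) = 0 := by
  have hp := (Fact.out : p.Prime).two_le
  have hq : ∀ n ≠ 0, ∃ m, p ^ n = m + 2 := fun n hn =>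
    ⟨p ^ n - 2, (Nat.sub_add_cancel (hp.trans (Nat.le_self_pow hn p))).symm⟩
  obtain ⟨q, hqa⟩ := hq a ha
  obtain ⟨q', hqb⟩ := hq b hb
  have hψ' := hψ
  have hφ' := hφ
  rw [mem_frobeniusMaps, hqb] at hψ'
  rw [mem_frobeniusMaps, hqa] at hφ'
  -- As xv is in the socle, so is ψ(xv) = x^(p^b) ψ(v). With z^(p^b) ψ(v) = ψ(zv) = 0 this puts
  -- (xz)^(p^b - 1) ψ(v) in the socle, and φ keeps it there.
  obtain ⟨-, -, hsz⟩ := frobeniusMaps_socle hxy0 hyz0 hdiv hψ (v := x • v)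
    (by rw [smul_smul, ← sq, hxv]) (by rw [smul_smul, mul_comm, hxy0, zero_smul])
    (by rw [smul_comm, hzv, smul_zero])
  obtain ⟨hw, -, -⟩ := frobeniusMaps_socle hxy0 hyz0 hdiv hφ (v := (x * z) ^ (q' + 1) • ψ v)
    (by
      have : x * (x * z) ^ (q' + 1) = z ^ q' * z * x ^ (q' + 2) := by ring
      rw [smul_smul, this, mul_smul, ← hψ', mul_smul, hsz, smul_zero])
    (by
      have : y * (x * z) ^ (q' + 1) = 0 := by linear_combination (x * z) ^ q' * z * hxy0
      rw [smul_smul, this, zero_smul])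
    (by
      have : z * (x * z) ^ (q' + 1) = x ^ (q' + 1) * z ^ (q' + 2) := by ring
      rw [smul_smul, this, mul_smul, ← hψ', hzv, map_zero, smul_zero])
  -- The second summand comes from applying φ to (xz)^(p^b - 1) ψ(v). The first is p^a - 1 ≥ 1,
  -- which leaves a factor x to kill the resulting socle element.
  have hQ : p ^ (a + b) - 1 = (q + 1) + (q' + 1) * (q + 2) := by
    rw [pow_add, hqa, hqb, Nat.sub_eq_iff_eq_add (Nat.succ_le_of_lt (by positivity))]
    ring
  rw [hφ'] at hw
  rw [hQ, pow_add, pow_mul, mul_smul, pow_succ, mul_comm x z, mul_smul, mul_smul, mul_comm z x, hw,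
    smul_zero, smul_zero]

/-- If `𝔪 = (x, z, y)` with `xy = yz = 0` and `x, z` regular modulo `y` in either order, then the
Frobenius algebra of the injective hull of the residue field is not finitely generated. -/
theorem not_frobeniusAlgebraFG [Fact p.Prime] [CharP A p] [IsLocalRing A] [IsNoetherianRing A]
    {ι : IsLocalRing.ResidueField A →ₗ[A] E} (hι : IsInjectiveHull ι)
    (hm : IsLocalRing.maximalIdeal A = Ideal.span {x, z, y}) (hx0 : x ≠ 0) (hy0 : y ≠ 0)
    (hxy0 : x * y = 0) (hyz0 : y * z = 0)
    (hxy : ∀ c a, x * c = y * a → ∃ b, c = y * b)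
    (hzy : ∀ c a, z * c = y * a → ∃ b, c = y * b)
    (hx : ∀ c a b, x * c = z * a + y * b → ∃ a' b', c = z * a' + y * b')
    (hz : ∀ c a b, z * c = x * a + y * b → ∃ a' b', c = x * a' + y * b') :
    ¬ FrobeniusAlgebraFG p A E := by
  classical
  rintro ⟨T, hT⟩
  have hp : 0 < p := (Fact.out : p.Prime).pos
  obtain ⟨s, hs, hs1, hsK, hgen, hann⟩ := hι.exists_dual_system hm hxy hzy hx hz
  -- An element b with ba = 0 is a nonunit because a ≠ 0, hence kills the socle element v.
  have hdiv1 : ∀ a : A, a ≠ 0 → ∀ v : E, x • v = 0 → y • v = 0 → z • v = 0 → ∃ w, a • w = v := by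
    intro a ha v hxv hyv hzv
    obtain ⟨w, hw, -⟩ := exists_smul_eq_of_injective hι.injective_module ⊥ a v fun b hb => by
      have hbm : b ∈ IsLocalRing.maximalIdeal A := fun hu => ha (by
        simpa using (hu.mul_right_eq_zero).1 ((Submodule.mem_bot A).1 hb))
      obtain ⟨α, β, γ, rfl⟩ := Submodule.mem_span_triple.1 (hm ▸ hbm)
      simp only [add_smul, smul_assoc, hxv, hyv, hzv, smul_zero, add_zero]
    exact ⟨w, hw⟩
  have hdiv : ∀ v : E, x • v = 0 → y • v = 0 → z • v = 0 → (∃ w, x • w = v) ∧ ∃ w, y • w = v :=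
    fun v h1 h2 h3 => ⟨hdiv1 x hx0 v h1 h2 h3, hdiv1 y hy0 v h1 h2 h3⟩
  obtain ⟨N, hN⟩ : ∃ N : ℕ, ∀ f ∈ T, ∀ e > N, f e = 0 := by
    refine ⟨T.sup fun f => f.support.sup id, fun f hf e he => ?_⟩
    by_contra hne
    have h1 : e ≤ f.support.sup id := Finset.le_sup (f := id) (DFinsupp.mem_support_iff.2 hne)
    exact absurd (h1.trans (Finset.le_sup (f := fun f => f.support.sup id) hf)) (not_le.2 he)
  -- Degrees up to N are unconstrained, so W contains the generators. A product in degree above N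
  -- either has a factor of degree zero, which is linear and preserves the condition, or is covered
  -- by the obstruction.
  let W : Subring (FrobeniusAlgebra p A E) :=
    { carrier := {f | ∀ e > N, ∀ v : E, z • v = 0 → x ^ 2 • v = 0 →
        (x * z) ^ (p ^ e - 1) • (f e : AddMonoid.End E) v = 0}
      zero_mem' := fun e _ v _ _ => smul_zero _
      one_mem' := fun e he v _ _ => by
        have : (1 : FrobeniusAlgebra p A E) e = 0 := DirectSum.of_eq_of_ne _ _ _ (by omega)
        rw [this]
        exact smul_zero _
      add_mem' := fun {f g} hf hg e he v h1 h2 => by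
        change _ • ((f e : AddMonoid.End E) v + (g e : AddMonoid.End E) v) = 0
        rw [smul_add, hf e he v h1 h2, hg e he v h1 h2, add_zero]
      neg_mem' := fun {f} hf e he v h1 h2 => by
        change _ • -((f e : AddMonoid.End E) v) = 0
        rw [smul_neg, hf e he v h1 h2, neg_zero]
      mul_mem' := fun {f g} hf hg e he v h1 h2 => by
        have hsum := AddMonoidHom.finsetSum_apply (M := E) (N := E)
          (fun ij : ℕ × ℕ => (f ij.1 : AddMonoid.End E) * (g ij.2 : AddMonoid.End E))
          (Finset.HasAntidiagonal.antidiagonal e) v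
        rw [DirectSum.coe_mul_apply_eq_sum_antidiagonal]
        refine (congrArg _ hsum).trans ?_
        rw [Finset.smul_sum]
        refine Finset.sum_eq_zero fun ij hij => ?_
        obtain ⟨i, j⟩ := ij
        obtain rfl : i + j = e := Finset.HasAntidiagonal.mem_antidiagonal.1 hij
        change _ • (f i : AddMonoid.End E) ((g j : AddMonoid.End E) v) = 0
        by_cases hi : i = 0
        · subst hi
          have hf0 : ∀ (r : A) (w : E), (f 0 : AddMonoid.End E) (r • w) =
              r • (f 0 : AddMonoid.End E) w := fun r w => by
            simpa using mem_frobeniusMaps.1 (f 0).2 r w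
          rw [zero_add] at he ⊢
          rw [← hf0, hg j he v h1 h2, map_zero]
        by_cases hj : j = 0
        · subst hj
          have hg0 : ∀ (r : A) (w : E), (g 0 : AddMonoid.End E) (r • w) =
              r • (g 0 : AddMonoid.End E) w := fun r w => by
            simpa using mem_frobeniusMaps.1 (g 0).2 r w
          exact hf i he _ (by rw [← hg0, h1, map_zero]) (by rw [← hg0, h2, map_zero])
        exact frobeniusMaps_mul_obstruction hxy0 hyz0 hdiv hi hj (f i).2 (g j).2 h1 h2 }
  have hW : W = ⊤ := by
    rw [eq_top_iff, ← hT, Subring.closure_le]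
    rintro f (⟨g, rfl⟩ | hf) e he v - -
    · have : (DirectSum.of (fun e : ℕ => frobeniusMaps p A E e) 0 g) e = 0 :=
        DirectSum.of_eq_of_ne _ _ _ (by omega)
      rw [this]
      exact smul_zero _
    · rw [hN f hf e he]
      exact smul_zero _
  set e := N + 1
  let M : Submodule A E := LinearMap.ker (LinearMap.lsmul A E y)
  have hM : ∀ v, v ∈ M ↔ y • v = 0 := fun v => Iff.rfl
  have hsM : ∀ n, s n ∈ M := fun n => hsK n y (Ideal.subset_span (by simp))
  -- θ is the e-th Frobenius on the kernel of y. Precomposing with x, whose image lies in that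
  -- kernel because xy = 0, extends it to all of E.
  obtain ⟨θ, hθ⟩ := exists_semilinear_of_directed (M := M) (N := E) (iterateFrobenius A p e)
    (s := fun n => ⟨s n, hsM n⟩) (d := x * z) (w := fun n => s (p ^ e * n))
    (fun n => Subtype.ext (hs n))
    (fun n => by
      rw [iterateFrobenius_def]
      exact pow_smul_of_smul_succ hs (p ^ e * n) (p ^ e))
    (fun v => by
      obtain ⟨r, n, hr⟩ := hgen v v.2
      exact ⟨r, n, Subtype.ext hr⟩)
    (fun n r hr => by
      obtain ⟨a, b, c, rfl⟩ := Submodule.mem_span_triple.1 (hann n r (congrArg Subtype.val hr))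
      refine hsK _ _ ?_
      simp only [smul_eq_mul, map_add, map_mul, map_pow]
      rw [iterateFrobenius_def, iterateFrobenius_def, iterateFrobenius_def, iterateFrobenius_def,
        iterateFrobenius_def, iterateFrobenius_def, ← pow_mul, ← pow_mul]
      refine add_mem (add_mem ?_ ?_) ?_
      · exact Ideal.mul_mem_left _ _ (Ideal.subset_span (by simp))
      · exact Ideal.mul_mem_left _ _ (Ideal.subset_span (by simp))
      · exact Ideal.mul_mem_left _ _
          (Ideal.pow_mem_of_mem _ (Ideal.subset_span (by simp)) _ (pow_pos hp e)))
  have hxM : ∀ v, x • v ∈ M := fun v => by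
    rw [hM, smul_smul, mul_comm, hxy0, zero_smul]
  let φ : AddMonoid.End E := AddMonoidHom.mk' (fun v => θ ⟨x • v, hxM v⟩) fun v w => by
    rw [← map_add]
    exact congrArg θ (Subtype.ext (smul_add x v w))
  have hθs : ∀ (r : A) (v : M), θ (r • v) = r ^ p ^ e • θ v := fun r v => by
    obtain ⟨a, n, hv⟩ := hgen v v.2
    obtain rfl : v = a • (⟨s n, hsM n⟩ : M) := Subtype.ext hv
    rw [smul_smul, hθ, hθ, map_mul, mul_smul, iterateFrobenius_def]
  have hφ : φ ∈ frobeniusMaps p A E e := by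
    rw [mem_frobeniusMaps]
    intro r v
    change θ _ = _ • θ _
    rw [← hθs]
    exact congrArg θ (Subtype.ext (smul_comm x r v))
  -- The test vector z s_2 is killed by z and x², and φ(z s_2) = θ(xz s_2) = θ(s_1) = s_{p^e}.
  have hmem : DirectSum.of (fun e : ℕ => frobeniusMaps p A E e) e ⟨φ, hφ⟩ ∈ W := hW ▸ trivial
  have h1 := hmem e (Nat.lt_succ_self N) (z • s 2)
    (by rw [smul_smul, ← sq, hsK 2 _ (Ideal.subset_span (by simp))])
    (by rw [smul_comm, hsK 2 _ (Ideal.subset_span (by simp)), smul_zero])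
  rw [DirectSum.of_eq_same] at h1
  have h2 : φ (z • s 2) = s (p ^ e) := by
    have h3 : (⟨x • z • s 2, hxM _⟩ : M) = (1 : A) • ⟨s 1, hsM 1⟩ :=
      Subtype.ext ((smul_smul x z (s 2)).trans ((hs 1).trans (one_smul A (s 1)).symm))
    change θ _ = _
    rw [h3, hθ, map_one, one_smul, mul_one]
  change (x * z) ^ (p ^ e - 1) • φ (z • s 2) = 0 at h1
  have h4 := pow_smul_of_smul_succ hs 1 (p ^ e - 1)
  rw [Nat.add_sub_cancel' (Nat.one_le_iff_ne_zero.2 (pow_pos hp e).ne')] at h4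
  rw [h2, h4] at h1
  exact hs1 h1

end NotFinitelyGenerated

/-! ### Ideals generated by variables in power series rings -/

section PowerSeries

variable {σ : Type*} {k : Type*} [Field k]

open Classical in
/-- The endomorphism of a power series ring that sets the variables in `s` to zero. -/
noncomputable def killVars (s : Finset σ) : MvPowerSeries σ k →+* MvPowerSeries σ k where
  toFun f := fun m => if ∀ i ∈ s, m i = 0 then MvPowerSeries.coeff m f else 0
  map_one' := by
    ext m
    change (if ∀ i ∈ s, m i = 0 then MvPowerSeries.coeff m (1 : MvPowerSeries σ k) else 0) = _
    rw [MvPowerSeries.coeff_one]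
    by_cases hm : m = 0 <;> simp [hm]
  map_zero' := by
    ext m
    change (if ∀ i ∈ s, m i = 0 then MvPowerSeries.coeff m (0 : MvPowerSeries σ k) else 0) = _
    simp
  map_add' f g := by
    ext m
    change (if ∀ i ∈ s, m i = 0 then MvPowerSeries.coeff m (f + g) else 0) =
      (if ∀ i ∈ s, m i = 0 then MvPowerSeries.coeff m f else 0) +
        if ∀ i ∈ s, m i = 0 then MvPowerSeries.coeff m g else 0
    split_ifs <;> simp
  map_mul' f g := by
    ext m
    refine Eq.trans ?_ (MvPowerSeries.coeff_mul ..).symm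
    change (if ∀ i ∈ s, m i = 0 then MvPowerSeries.coeff m (f * g) else 0) =
      ∑ q ∈ Finset.HasAntidiagonal.antidiagonal m,
        (if ∀ i ∈ s, q.1 i = 0 then MvPowerSeries.coeff q.1 f else 0) *
          (if ∀ i ∈ s, q.2 i = 0 then MvPowerSeries.coeff q.2 g else 0)
    rw [MvPowerSeries.coeff_mul]
    split_ifs with hm
    · refine Finset.sum_congr rfl fun q hq => ?_
      rw [← Finset.HasAntidiagonal.mem_antidiagonal.1 hq] at hm
      rw [if_pos fun i hi => (Nat.add_eq_zero_iff.1 (hm i hi)).1,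
        if_pos fun i hi => (Nat.add_eq_zero_iff.1 (hm i hi)).2]
    · refine (Finset.sum_eq_zero fun q hq => ?_).symm
      by_cases h1 : ∀ i ∈ s, q.1 i = 0
      · by_cases h2 : ∀ i ∈ s, q.2 i = 0
        · refine absurd (fun i hi => ?_) hm
          rw [← Finset.HasAntidiagonal.mem_antidiagonal.1 hq, Finsupp.add_apply, h1 i hi, h2 i hi]
        · rw [if_neg h2, mul_zero]
      · rw [if_neg h1, zero_mul]

theorem killVars_eq_zero_iff {s : Finset σ} {f : MvPowerSeries σ k} :
    killVars s f = 0 ↔ ∀ m : σ →₀ ℕ, (∀ i ∈ s, m i = 0) → MvPowerSeries.coeff m f = 0 := by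
  classical
  rw [MvPowerSeries.ext_iff]
  refine forall_congr' fun m => ?_
  change (if ∀ i ∈ s, m i = 0 then MvPowerSeries.coeff m f else 0) = 0 ↔ _
  by_cases h : ∀ i ∈ s, m i = 0
  · rw [if_pos h]
    exact ⟨fun h' _ => h', fun h' => h' h⟩
  · rw [if_neg h]
    exact ⟨fun _ h' => absurd h' h, fun _ => rfl⟩

variable (k) in
/-- The ideal generated by the variables in `s`. -/
noncomputable def varIdeal (s : Finset σ) : Ideal (MvPowerSeries σ k) :=
  Ideal.span (MvPowerSeries.X '' (s : Set σ))

theorem X_mem_varIdeal {s : Finset σ} {i : σ} (hi : i ∈ s) :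
    (MvPowerSeries.X i : MvPowerSeries σ k) ∈ varIdeal k s :=
  Ideal.subset_span ⟨i, hi, rfl⟩

theorem varIdeal_insert [DecidableEq σ] (s : Finset σ) (i : σ) :
    varIdeal k (insert i s) = Ideal.span {MvPowerSeries.X i} ⊔ varIdeal k s := by
  rw [varIdeal, Finset.coe_insert, Set.image_insert_eq, Ideal.span_insert]
  rfl

/-- The forward direction says that `killVars s` kills the generators. The converse splits off, one
variable at a time, the terms divisible by it. So `varIdeal k s` is the kernel of a map to a domain.
-/
theorem mem_varIdeal_iff {s : Finset σ} {f : MvPowerSeries σ k} :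
    f ∈ varIdeal k s ↔ ∀ m : σ →₀ ℕ, (∀ i ∈ s, m i = 0) → MvPowerSeries.coeff m f = 0 := by
  classical
  constructor
  · rw [← killVars_eq_zero_iff, ← RingHom.mem_ker]
    refine fun hf => Ideal.span_le.2 ?_ hf
    rintro _ ⟨i, hi, rfl⟩
    rw [SetLike.mem_coe, RingHom.mem_ker, killVars_eq_zero_iff]
    exact fun m hm => MvPowerSeries.X_dvd_iff.1 dvd_rfl m (hm i hi)
  · induction s using Finset.induction_on generalizing f with
    | empty =>
      intro h
      rw [show f = 0 from MvPowerSeries.ext fun m => by simpa using h m (by simp)]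
      exact zero_mem _
    | insert i s _ ih =>
      intro h
      let g : MvPowerSeries σ k := fun m => if m i = 0 then 0 else MvPowerSeries.coeff m f
      have hg : ∀ m, MvPowerSeries.coeff m g = if m i = 0 then 0 else MvPowerSeries.coeff m f :=
        fun m => rfl
      rw [varIdeal_insert, ← add_sub_cancel g f]
      refine Submodule.add_mem_sup (Ideal.mem_span_singleton.2 (MvPowerSeries.X_dvd_iff.2
        fun m hm => by rw [hg, if_pos hm])) (ih fun m hm => ?_)
      rw [map_sub, hg]
      split_ifs with h0
      · rw [sub_zero]
        exact h m fun j hj => (Finset.mem_insert.1 hj).elim (fun h => h ▸ h0) (hm j)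
      · rw [sub_self]

instance varIdeal_isPrime (s : Finset σ) : (varIdeal k s).IsPrime := by
  have : varIdeal k s = RingHom.ker (killVars s : MvPowerSeries σ k →+* MvPowerSeries σ k) := by
    ext f
    rw [mem_varIdeal_iff, RingHom.mem_ker, killVars_eq_zero_iff]
  rw [this]
  have : IsDomain (MvPowerSeries σ k) := NoZeroDivisors.to_isDomain _
  exact RingHom.ker_isPrime _

theorem X_mem_varIdeal_iff {s : Finset σ} {i : σ} :
    (MvPowerSeries.X i : MvPowerSeries σ k) ∈ varIdeal k s ↔ i ∈ s := by
  classical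
  refine ⟨fun h => ?_, X_mem_varIdeal⟩
  by_contra hi
  have := mem_varIdeal_iff.1 h (Finsupp.single i 1) fun j hj => by
    rw [Finsupp.single_apply, if_neg]
    rintro rfl
    exact hi hj
  rw [MvPowerSeries.coeff_index_single_self_X] at this
  exact one_ne_zero this

theorem maximalIdeal_eq_varIdeal [Fintype σ] :
    IsLocalRing.maximalIdeal (MvPowerSeries σ k) = varIdeal k Finset.univ := by
  ext f
  rw [IsLocalRing.mem_maximalIdeal, mem_nonunits_iff, MvPowerSeries.isUnit_iff_constantCoeff,
    isUnit_iff_ne_zero, not_not, mem_varIdeal_iff]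
  constructor
  · intro h m hm
    rwa [show m = 0 from Finsupp.ext fun i => hm i (Finset.mem_univ i),
      MvPowerSeries.coeff_zero_eq_constantCoeff_apply]
  · intro h
    rw [← MvPowerSeries.coeff_zero_eq_constantCoeff_apply]
    exact h 0 fun _ _ => rfl

theorem maximalIdeal_eq_map_of_surjective {R B : Type*} [CommRing R] [CommRing B] [IsLocalRing R]
    [IsLocalRing B] (f : R →+* B) (hf : Function.Surjective f) :
    IsLocalRing.maximalIdeal B = (IsLocalRing.maximalIdeal R).map f := by
  have := Ideal.comap_isMaximal_of_surjective f hf (K := IsLocalRing.maximalIdeal B)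
  rw [← IsLocalRing.eq_maximalIdeal this, Ideal.map_comap_of_surjective f hf]

/-- If all variables but one are set to zero in a power series ring, the result is a principal ideal
ring. -/
theorem isPrincipalIdealRing_quotient_varIdeal [Fintype σ] [DecidableEq σ] {s : Finset σ} {j : σ}
    (hj : insert j s = Finset.univ) :
    IsPrincipalIdealRing (MvPowerSeries σ k ⧸ varIdeal k s) := by
  have : IsLocalRing (MvPowerSeries σ k ⧸ varIdeal k s) :=
    IsLocalRing.of_surjective' (Ideal.Quotient.mk _) Ideal.Quotient.mk_surjective
  refine ((tfae_of_isNoetherianRing_of_isLocalRing_of_isDomain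
    (MvPowerSeries σ k ⧸ varIdeal k s)).out 4 0).1 ?_
  rw [maximalIdeal_eq_map_of_surjective _ Ideal.Quotient.mk_surjective, maximalIdeal_eq_varIdeal,
    ← hj, varIdeal_insert, Ideal.map_sup, Ideal.map_quotient_self, sup_bot_eq, Ideal.map_span,
    Set.image_singleton]
  exact ⟨_, rfl⟩

/-- A prime ideal that contains all variables but two, and does not contain one of these two, is
generated by the variables it is known to contain and one further element. -/
theorem exists_eq_varIdeal_sup_span [Fintype σ] [DecidableEq σ] {s : Finset σ} {i j : σ}
    (hij : insert j (insert i s) = Finset.univ) {P : Ideal (MvPowerSeries σ k)} [P.IsPrime]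
    (hi : MvPowerSeries.X i ∉ P) (hs : varIdeal k s ≤ P) :
    ∃ g, P = varIdeal k s ⊔ Ideal.span {g} := by
  have := isPrincipalIdealRing_quotient_varIdeal (k := k) hij
  obtain ⟨b, hb⟩ := (IsPrincipalIdealRing.principal
    (P.map (Ideal.Quotient.mk (varIdeal k (insert i s))))).principal
  rw [← Ideal.span] at hb
  obtain ⟨g, hg, rfl⟩ := (Ideal.mem_map_iff_of_surjective _ Ideal.Quotient.mk_surjective).1
    (hb ▸ Ideal.mem_span_singleton_self b)
  refine ⟨g, le_antisymm ?_ (sup_le hs ((Ideal.span_singleton_le_iff_mem P).2 hg))⟩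
  -- Nakayama: modulo `varIdeal k s` and g, any f ∈ P is a multiple X_i c, and c ∈ P because X_i ∉
  -- P. Hence P = (s) + (g) + X_i P.
  refine Submodule.le_of_le_smul_of_le_jacobson_bot (I := IsLocalRing.maximalIdeal _)
    (IsNoetherian.noetherian P) (IsLocalRing.maximalIdeal_le_jacobson _) fun f hf => ?_
  have hf' := Ideal.mem_map_of_mem (Ideal.Quotient.mk (varIdeal k (insert i s))) hf
  rw [hb, Ideal.mem_span_singleton'] at hf'
  obtain ⟨a, ha⟩ := hf'
  obtain ⟨a, rfl⟩ := Ideal.Quotient.mk_surjective a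
  rw [← map_mul, Ideal.Quotient.eq, varIdeal_insert, Submodule.mem_sup] at ha
  obtain ⟨c, hc, d, hd, hcd⟩ := ha
  obtain ⟨c, rfl⟩ := Ideal.mem_span_singleton.1 hc
  have hcP : c ∈ P := by
    refine (Ideal.IsPrime.mem_or_mem ‹P.IsPrime› (x := MvPowerSeries.X i) ?_).resolve_left hi
    rw [eq_sub_of_add_eq hcd]
    exact sub_mem (sub_mem (P.mul_mem_left _ hg) hf) (hs hd)
  have hfe : f = (a * g - d) + -(MvPowerSeries.X i * c) := by linear_combination hcd
  rw [hfe]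
  refine Submodule.add_mem_sup (sub_mem ?_ ?_) (neg_mem (Submodule.smul_mem_smul ?_ hcP))
  · exact Ideal.mem_sup_right (Ideal.mul_mem_left _ _ (Ideal.mem_span_singleton_self g))
  · exact Ideal.mem_sup_left hd
  · rw [maximalIdeal_eq_varIdeal]
    exact X_mem_varIdeal (Finset.mem_univ i)

end PowerSeries

/-! ### The finitely generated locus of the example -/

section Locus

variable {k : Type u} [Field k]

theorem charP_of_ringHom_from_powerSeries {p : ℕ} [CharP k p] {σ : Type*} {A : Type*} [CommRing A]
    [Nontrivial A] (f : MvPowerSeries σ k →+* A) : CharP A p :=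
  charP_of_injective_ringHom (f := f.comp (MvPowerSeries.C (σ := σ) (R := k)))
    (RingHom.injective _) p

/-- The Frobenius algebra is finitely generated at a prime that does not contain some variable `X i`,
provided that there is only one minimal prime that does not contain `X i` and that it is generated by
all variables but `X i` and `X j`. -/
theorem frobeniusAlgebraFG_of_X_notMem {n : ℕ} {p : ℕ} [Fact p.Prime] [CharP k p]
    {I : Ideal (MvPowerSeries (Fin n) k)} {s : Finset (Fin n)} {i j : Fin n}
    (hij : insert j (insert i s) = Finset.univ) (hI : I ≤ varIdeal k s)
    (his : ∀ l ∈ s, (MvPowerSeries.X i * MvPowerSeries.X l : MvPowerSeries (Fin n) k) ∈ I)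
    (Q : Ideal (MvPowerSeries (Fin n) k ⧸ I)) [Q.IsPrime]
    (hi : Ideal.Quotient.mk I (MvPowerSeries.X i) ∉ Q) {A : Type u} [CommRing A]
    [Algebra (MvPowerSeries (Fin n) k ⧸ I) A] [IsLocalization.AtPrime A Q] [IsLocalRing A]
    {E : Type u} [AddCommGroup E] [Module A E] {ι : IsLocalRing.ResidueField A →ₗ[A] E}
    (hι : IsInjectiveHull ι) :
    FrobeniusAlgebraFG p A E := by
  let π := Ideal.Quotient.mk I
  let f : MvPowerSeries (Fin n) k →+* A := (algebraMap _ A).comp π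
  let P : Ideal (MvPowerSeries (Fin n) k) := Q.comap π
  have hfP : ∀ a, a ∉ P → IsUnit (f a) := fun a ha =>
    IsLocalization.map_units A (⟨π a, ha⟩ : Q.primeCompl)
  have hfs : varIdeal k s ≤ RingHom.ker f := by
    rw [varIdeal, Ideal.span_le]
    rintro _ ⟨l, hl, rfl⟩
    have : f (MvPowerSeries.X i * MvPowerSeries.X l) = 0 := by
      change algebraMap _ A (π _) = 0
      rw [Ideal.Quotient.eq_zero_iff_mem.2 (his l hl), map_zero]
    rw [map_mul] at this
    exact ((hfP _ hi).mul_right_eq_zero).1 this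
  have hsP : varIdeal k s ≤ P := by
    intro a ha
    by_contra haP
    have h1 := hfP a haP
    rw [(RingHom.mem_ker (f := f)).1 (hfs ha)] at h1
    exact not_isUnit_zero h1
  obtain ⟨g, hg⟩ := exists_eq_varIdeal_sup_span hij (P := P) hi hsP
  have hmax : IsLocalRing.maximalIdeal A = Ideal.span {f g} := by
    have h1 : Q = P.map π :=
      (Ideal.map_comap_of_surjective π Ideal.Quotient.mk_surjective _).symm
    rw [← IsLocalization.AtPrime.map_eq_maximalIdeal Q A, h1, Ideal.map_map]
    change P.map f = _
    rw [hg, Ideal.map_sup, (Ideal.map_eq_bot_iff_le_ker f).2 hfs, bot_sup_eq, Ideal.map_span,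
      Set.image_singleton]
  -- A is a localization of the domain R/(s): a zero product of fractions is cleared to a product in
  -- `varIdeal k s`, which is prime and avoids the denominators.
  have hdom : NoZeroDivisors A := by
    refine ⟨fun {a b} hab => ?_⟩
    obtain ⟨⟨u, v⟩, hu⟩ := IsLocalization.surj Q.primeCompl a
    obtain ⟨⟨u', v'⟩, hu'⟩ := IsLocalization.surj Q.primeCompl b
    obtain ⟨u, rfl⟩ := Ideal.Quotient.mk_surjective u
    obtain ⟨u', rfl⟩ := Ideal.Quotient.mk_surjective u'
    have h1 : algebraMap _ A (π u * π u') = 0 := by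
      rw [map_mul]
      refine (congrArg₂ (· * ·) hu hu').symm.trans ?_
      linear_combination (algebraMap _ A (v : _ ⧸ I) * algebraMap _ A (v' : _ ⧸ I)) * hab
    obtain ⟨⟨w, hw⟩, h2⟩ := (IsLocalization.map_eq_zero_iff Q.primeCompl A _).1 h1
    obtain ⟨w, rfl⟩ := Ideal.Quotient.mk_surjective w
    have h3 : w * (u * u') ∈ varIdeal k s :=
      hI (Ideal.Quotient.eq_zero_iff_mem.1 (by rw [map_mul, map_mul]; exact h2))
    have h4 : ∀ {a : A} {u v}, a * algebraMap _ A ((v : Q.primeCompl) : _ ⧸ I) =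
        algebraMap _ A (π u) → u ∈ varIdeal k s → a = 0 := fun {a u v} he hus =>
      ((IsLocalization.map_units A v).mul_left_eq_zero).1 (he.trans (hfs hus))
    rcases (varIdeal_isPrime s).mem_or_mem h3 with h | h
    · exact absurd (hsP h) hw
    · exact ((varIdeal_isPrime s).mem_or_mem h).imp (h4 hu) (h4 hu')
  have : IsDomain A := NoZeroDivisors.to_isDomain A
  have : CharP A p := charP_of_ringHom_from_powerSeries f
  have : IsNoetherianRing A := IsLocalization.isNoetherianRing Q.primeCompl A inferInstance
  exact frobeniusAlgebraFG_of_isPrincipal ⟨f g, hmax⟩ hι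

end Locus

/-! ### The closed point and the other points of the example -/

section ExampleLocus

variable {k : Type u} [Field k]

theorem exampleIdeal_le_varIdeal_one : exampleIdeal k ≤ varIdeal k {1} := by
  rw [exampleIdeal, Ideal.span_le]
  rintro _ (rfl | rfl)
  · exact Ideal.mul_mem_left _ _ (X_mem_varIdeal (by simp))
  · exact Ideal.mul_mem_right _ _ (X_mem_varIdeal (by simp))

theorem exampleIdeal_le_varIdeal_zero_two : exampleIdeal k ≤ varIdeal k {0, 2} := by
  rw [exampleIdeal, Ideal.span_le]
  rintro _ (rfl | rfl)
  · exact Ideal.mul_mem_right _ _ (X_mem_varIdeal (by simp))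
  · exact Ideal.mul_mem_left _ _ (X_mem_varIdeal (by simp))

theorem X_zero_mul_X_one_mem :
    (MvPowerSeries.X 0 * MvPowerSeries.X 1 : MvPowerSeries (Fin 3) k) ∈ exampleIdeal k :=
  Ideal.subset_span (by simp)

theorem X_one_mul_X_two_mem :
    (MvPowerSeries.X 1 * MvPowerSeries.X 2 : MvPowerSeries (Fin 3) k) ∈ exampleIdeal k :=
  Ideal.subset_span (by simp)

theorem varIdeal_singleton (i : Fin 3) :
    varIdeal k {i} = Ideal.span {(MvPowerSeries.X i : MvPowerSeries (Fin 3) k)} := by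
  simp [varIdeal]

theorem varIdeal_pair (i j : Fin 3) : varIdeal k {i, j} =
    Ideal.span {(MvPowerSeries.X i : MvPowerSeries (Fin 3) k), MvPowerSeries.X j} := by
  simp [varIdeal, Set.image_insert_eq]

theorem not_frobeniusAlgebraFG_of_surjective {p : ℕ} [Fact p.Prime] [CharP k p] {A : Type u}
    [CommRing A] [IsLocalRing A] (f : MvPowerSeries (Fin 3) k →+* A) (hf : Function.Surjective f)
    (hker : RingHom.ker f = exampleIdeal k) {E : Type u} [AddCommGroup E] [Module A E]
    {ι : IsLocalRing.ResidueField A →ₗ[A] E} (hι : IsInjectiveHull ι) :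
    ¬ FrobeniusAlgebraFG p A E := by
  have : CharP A p := charP_of_ringHom_from_powerSeries f
  have : IsNoetherianRing A := isNoetherianRing_of_surjective _ _ f hf
  have hmem : ∀ s : Finset (Fin 3), exampleIdeal k ≤ varIdeal k s → ∀ a,
      f a ∈ (varIdeal k s).map f ↔ a ∈ varIdeal k s := fun s hs a => by
    rw [← Ideal.mem_comap, Ideal.comap_map_of_surjective f hf, ← RingHom.ker_eq_comap_bot, hker,
      sup_eq_left.2 hs]
  -- All required regularity reduces to primality: the image of `varIdeal k s` is prime and X_i
  -- stays outside it.
  have hreg : ∀ (s : Finset (Fin 3)) (i : Fin 3), exampleIdeal k ≤ varIdeal k s → i ∉ s → ∀ c,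
      f (MvPowerSeries.X i) * c ∈ (varIdeal k s).map f → c ∈ (varIdeal k s).map f := by
    intro s i hs hi c hc
    have := Ideal.map_isPrime_of_surjective hf (I := varIdeal k s) (hker.trans_le hs)
    exact (this.mem_or_mem hc).resolve_left fun h =>
      hi (X_mem_varIdeal_iff.1 ((hmem s hs _).1 h))
  have h0 : ∀ a ∈ exampleIdeal k, f a = 0 := fun a ha => by rwa [← RingHom.mem_ker, hker]
  have hle1 := exampleIdeal_le_varIdeal_one (k := k)
  have hle : ∀ i : Fin 3, exampleIdeal k ≤ varIdeal k {i, 1} := fun i =>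
    hle1.trans (Ideal.span_mono (Set.image_mono (by simp)))
  have hsingle : ∀ i : Fin 3, i ≠ 1 → ∀ c a, f (MvPowerSeries.X i) * c = f (MvPowerSeries.X 1) * a →
      ∃ b, c = f (MvPowerSeries.X 1) * b := fun i hi c a h => by
    have h1 := hreg {1} i hle1 (by simpa using hi) c (by
      rw [h]
      exact Ideal.mul_mem_right _ _ (Ideal.mem_map_of_mem f (X_mem_varIdeal (by simp))))
    rw [varIdeal_singleton, Ideal.map_span, Set.image_singleton] at h1
    exact Ideal.mem_span_singleton.1 h1
  have hpair : ∀ i j : Fin 3, i ∉ ({j, 1} : Finset (Fin 3)) → ∀ c a b,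
      f (MvPowerSeries.X i) * c = f (MvPowerSeries.X j) * a + f (MvPowerSeries.X 1) * b →
      ∃ a' b', c = f (MvPowerSeries.X j) * a' + f (MvPowerSeries.X 1) * b' := fun i j hi c a b h => by
    have h1 := hreg {j, 1} i (hle j) hi c (by
      rw [h]
      refine add_mem ?_ ?_ <;>
        exact Ideal.mul_mem_right _ _ (Ideal.mem_map_of_mem f (X_mem_varIdeal (by simp))))
    rw [varIdeal_pair, Ideal.map_span, Set.image_pair] at h1
    obtain ⟨a', b', h2⟩ := Ideal.mem_span_pair.1 h1
    exact ⟨a', b', by rw [← h2]; ring⟩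
  refine not_frobeniusAlgebraFG hι (x := f (MvPowerSeries.X 0)) (y := f (MvPowerSeries.X 1))
    (z := f (MvPowerSeries.X 2)) ?_ ?_ ?_ ?_ ?_ (hsingle 0 (by decide)) (hsingle 2 (by decide))
    (hpair 0 2 (by decide)) (hpair 2 0 (by decide))
  · rw [maximalIdeal_eq_map_of_surjective f hf, maximalIdeal_eq_varIdeal,
      show (Finset.univ : Finset (Fin 3)) = {0, 2, 1} by decide, varIdeal, Ideal.map_span]
    simp [Set.image_insert_eq]
  · intro h
    rw [← RingHom.mem_ker, hker] at h
    exact absurd (X_mem_varIdeal_iff.1 (hle1 h)) (by decide)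
  · intro h
    rw [← RingHom.mem_ker, hker] at h
    exact absurd (X_mem_varIdeal_iff.1 (exampleIdeal_le_varIdeal_zero_two h)) (by decide)
  · rw [← map_mul, h0 _ X_zero_mul_X_one_mem]
  · rw [← map_mul, h0 _ X_one_mul_X_two_mem]

theorem closedPoint_notMem_fgLocus (p : ℕ) [Fact p.Prime] [CharP k p] :
    IsLocalRing.closedPoint (ExampleRing k) ∉ fgLocus p (ExampleRing k) := by
  set Q := IsLocalRing.closedPoint (ExampleRing k)
  -- Localizing a local ring at its maximal ideal changes nothing, so S_𝔪 is still a quotient of the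
  -- power series ring by I.
  have hbij : Function.Bijective (algebraMap (ExampleRing k) (Localization.AtPrime Q.asIdeal)) :=
    (IsLocalization.atUnits (ExampleRing k) Q.asIdeal.primeCompl
      (S := Localization.AtPrime Q.asIdeal) fun a ha => by
        by_contra h
        exact ha ((IsLocalRing.mem_maximalIdeal a).2 h)).bijective
  refine not_frobeniusAlgebraFG_of_surjective
    ((algebraMap (ExampleRing k) (Localization.AtPrime Q.asIdeal)).comp (Ideal.Quotient.mk _))
    (hbij.2.comp Ideal.Quotient.mk_surjective) ?_ (InjectiveHull.isInjectiveHull _ _)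
  rw [← RingHom.comap_ker, (RingHom.injective_iff_ker_eq_bot _).1 hbij.1, ← RingHom.ker_eq_comap_bot,
    Ideal.mk_ker]

theorem mem_fgLocus_of_ne_closedPoint (p : ℕ) [Fact p.Prime] [CharP k p]
    {Q : PrimeSpectrum (ExampleRing k)} (hQ : Q ≠ IsLocalRing.closedPoint (ExampleRing k)) :
    Q ∈ fgLocus p (ExampleRing k) := by
  have hX : ∃ i : Fin 3, Ideal.Quotient.mk (exampleIdeal k) (MvPowerSeries.X i) ∉ Q.asIdeal := by
    by_contra! h
    refine hQ (PrimeSpectrum.ext ((IsLocalRing.le_maximalIdeal Q.isPrime.ne_top).antisymm ?_))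
    rw [maximalIdeal_eq_map_of_surjective _ Ideal.Quotient.mk_surjective, maximalIdeal_eq_varIdeal,
      Ideal.map_le_iff_le_comap, varIdeal, Ideal.span_le]
    rintro _ ⟨i, -, rfl⟩
    exact h i
  obtain ⟨i, hi⟩ := hX
  have hι := InjectiveHull.isInjectiveHull (Localization.AtPrime Q.asIdeal)
    (IsLocalRing.ResidueField (Localization.AtPrime Q.asIdeal))
  have h01 := X_zero_mul_X_one_mem (k := k)
  have h12 := X_one_mul_X_two_mem (k := k)
  have h10 := h01
  have h21 := h12
  rw [mul_comm] at h10 h21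
  -- Inverting x or z kills y and leaves two variables. Inverting y kills x and z, and then j = i
  -- since only y survives.
  fin_cases i
  · exact frobeniusAlgebraFG_of_X_notMem (s := {1}) (i := 0) (j := 2) (by decide)
      exampleIdeal_le_varIdeal_one (by simpa using h01) Q.asIdeal hi hι
  · exact frobeniusAlgebraFG_of_X_notMem (s := {0, 2}) (i := 1) (j := 1) (by decide)
      exampleIdeal_le_varIdeal_zero_two (by simpa using ⟨h10, h12⟩) Q.asIdeal hi hι
  · exact frobeniusAlgebraFG_of_X_notMem (s := {1}) (i := 2) (j := 0) (by decide)
      exampleIdeal_le_varIdeal_one (by simpa using h21) Q.asIdeal hi hι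

theorem fgLocus_exampleRing (p : ℕ) [Fact p.Prime] [CharP k p] :
    fgLocus p (ExampleRing k) = {IsLocalRing.closedPoint (ExampleRing k)}ᶜ := by
  ext Q
  refine ⟨?_, mem_fgLocus_of_ne_closedPoint p⟩
  rintro hQ rfl
  exact closedPoint_notMem_fgLocus p hQ

/-! ### The open subset of the example -/

theorem X_two_dvd_betaMonomial :
    (MvPowerSeries.X 2 : MvPowerSeries (Fin 3) k) ∣ betaMonomial (exampleIdeal k) := by
  classical
  refine Finset.dvd_prod_of_mem _ (Finset.mem_filter.2 ⟨Finset.mem_univ 2, ?_⟩)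
  obtain ⟨P, hP, hle⟩ := Ideal.exists_minimalPrimes_le (exampleIdeal_le_varIdeal_zero_two (k := k))
  have : P.IsPrime := hP.1.1
  refine le_sSup (a := P) hP ((this.mem_or_mem (hP.1.2 X_one_mul_X_two_mem)).resolve_left fun h => ?_)
  exact absurd (X_mem_varIdeal_iff.1 (hle h)) (by decide)

theorem frobeniusPower_exampleIdeal_le (p : ℕ) :
    frobeniusPower p (exampleIdeal k) ≤
      Ideal.span {(MvPowerSeries.X 1 : MvPowerSeries (Fin 3) k) ^ p} := by
  rw [frobeniusPower, Ideal.span_le]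
  rintro _ ⟨a, ha, rfl⟩
  have h := exampleIdeal_le_varIdeal_one ha
  rw [varIdeal_singleton, Ideal.mem_span_singleton] at h
  exact Ideal.mem_span_singleton.2 (pow_dvd_pow_of_dvd h p)

theorem X_pow_mul_X_pow_mem_idealJ (p : ℕ) [hp : Fact p.Prime] :
    (MvPowerSeries.X 0 ^ p * MvPowerSeries.X 1 ^ (p - 1) : MvPowerSeries (Fin 3) k) ∈
      idealJ p (exampleIdeal k) := by
  -- The bound p ≥ 2 ensures that z divides the (p - 1)-st power of x^β.
  obtain ⟨q, rfl⟩ : ∃ q, p = q + 2 := ⟨p - 2, (Nat.sub_add_cancel hp.out.two_le).symm⟩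
  refine Ideal.subset_span ⟨⟨Finsupp.single 0 (q + 2) + Finsupp.single 1 (q + 2 - 1), ?_⟩, ?_, ?_⟩
  · rw [MvPowerSeries.X_pow_eq, MvPowerSeries.X_pow_eq, MvPowerSeries.monomial_mul_monomial, one_mul]
  · have hpow : ∀ b ∈ exampleIdeal k, ∀ c : MvPowerSeries (Fin 3) k,
        c * b ^ (q + 2) ∈ frobeniusPower (q + 2) (exampleIdeal k) := fun b hb c =>
      Ideal.mul_mem_left _ _ (Ideal.subset_span ⟨b, hb, rfl⟩)
    rw [Submodule.mem_colon]
    intro a ha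
    obtain ⟨u, v, rfl⟩ := Ideal.mem_span_pair.1 ha
    have := hpow _ X_zero_mul_X_one_mem (u * MvPowerSeries.X 0 + v * MvPowerSeries.X 2)
    convert this using 1
    rw [smul_eq_mul, show q + 2 - 1 = q + 1 from rfl]
    ring
  -- Modulo z the second ideal vanishes and the first lies in (y^p). Cancelling y^(p-1) would put
  -- x^p in (y, z).
  · intro h
    obtain ⟨a, ha, b, hb, hab⟩ := Submodule.mem_sup.1 h
    obtain ⟨a, rfl⟩ := Ideal.mem_span_singleton.1 (frobeniusPower_exampleIdeal_le _ ha)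
    have hb2 : b ∈ varIdeal k {2} := by
      obtain ⟨c, rfl⟩ := Ideal.mem_span_singleton.1 hb
      rw [varIdeal_singleton, Ideal.mem_span_singleton]
      exact ((X_two_dvd_betaMonomial (k := k)).trans (dvd_pow_self _ (by omega))).mul_right c
    have h1 : (MvPowerSeries.X 1 : MvPowerSeries (Fin 3) k) ^ (q + 1) *
        (MvPowerSeries.X 0 ^ (q + 2) - MvPowerSeries.X 1 * a) ∈ varIdeal k {2} := by
      rw [show q + 2 - 1 = q + 1 from rfl] at hab
      convert hb2 using 1
      linear_combination -hab
    have h2 := ((varIdeal_isPrime {2}).mem_or_mem h1).resolve_left fun h =>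
      absurd (X_mem_varIdeal_iff.1 ((varIdeal_isPrime {2}).mem_of_pow_mem _ h)) (by decide)
    have h3 : (MvPowerSeries.X 0 : MvPowerSeries (Fin 3) k) ^ (q + 2) ∈ varIdeal k {1, 2} := by
      rw [← sub_add_cancel (MvPowerSeries.X 0 ^ (q + 2)) (MvPowerSeries.X 1 * a)]
      refine add_mem (Ideal.span_mono (Set.image_mono (by simp)) h2)
        (Ideal.mul_mem_right _ _ (X_mem_varIdeal (by simp)))
    exact absurd (X_mem_varIdeal_iff.1 ((varIdeal_isPrime {1, 2}).mem_of_pow_mem _ h3)) (by decide)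

/-- An annihilating r satisfies r x^p y^(p-1) ∈ I^[p] ⊆ (y^p). Cancelling y^(p-1) gives r x^p ∈ (y),
and (y) is a prime not containing x. -/
theorem annihilator_moduleJ_le (p : ℕ) [hp : Fact p.Prime] :
    Module.annihilator (MvPowerSeries (Fin 3) k) (ModuleJ p (exampleIdeal k)) ≤ varIdeal k {1} := by
  intro r hr
  have hdom : IsDomain (MvPowerSeries (Fin 3) k) := NoZeroDivisors.to_isDomain _
  let m : ↥(frobeniusPower p (exampleIdeal k) ⊔ idealJ p (exampleIdeal k)) :=
    ⟨_, Ideal.mem_sup_right (X_pow_mul_X_pow_mem_idealJ p)⟩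
  have h1 := Module.mem_annihilator.1 hr (Submodule.Quotient.mk m)
  rw [← Submodule.Quotient.mk_smul, Submodule.Quotient.mk_eq_zero] at h1
  have h2 : r * (MvPowerSeries.X 0 ^ p * MvPowerSeries.X 1 ^ (p - 1)) ∈
      frobeniusPower p (exampleIdeal k) := h1
  obtain ⟨c, hc⟩ := Ideal.mem_span_singleton.1 (frobeniusPower_exampleIdeal_le _ h2)
  obtain ⟨q, rfl⟩ : ∃ q, p = q + 1 := ⟨p - 1, (Nat.sub_add_cancel hp.out.pos).symm⟩
  rw [Nat.add_sub_cancel] at hc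
  have hX1 : (MvPowerSeries.X 1 : MvPowerSeries (Fin 3) k) ^ q ≠ 0 := fun h => by
    have := (varIdeal_isPrime (k := k) {0}).mem_of_pow_mem (r := MvPowerSeries.X 1) q
      (h ▸ zero_mem _)
    exact absurd (X_mem_varIdeal_iff.1 this) (by decide)
  have h3 : r * MvPowerSeries.X 0 ^ (q + 1) = MvPowerSeries.X 1 * c :=
    mul_left_cancel₀ hX1 (by linear_combination hc)
  have h4 : r * MvPowerSeries.X 0 ^ (q + 1) ∈ varIdeal k {1} :=
    h3 ▸ Ideal.mul_mem_right _ _ (X_mem_varIdeal (by simp))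
  exact ((varIdeal_isPrime {1}).mem_or_mem h4).resolve_right fun h =>
    absurd (X_mem_varIdeal_iff.1 ((varIdeal_isPrime {1}).mem_of_pow_mem _ h)) (by decide)

theorem notMem_openSubset_of_le (p : ℕ) [Fact p.Prime] {Q : PrimeSpectrum (ExampleRing k)}
    (hQ : varIdeal k {1} ≤ Q.asIdeal.comap (Ideal.Quotient.mk _)) :
    Q ∉ openSubset p (exampleIdeal k) := by
  rw [openSubset, Set.mem_compl_iff, not_not, PrimeSpectrum.mem_zeroLocus, SetLike.coe_subset_coe,
    Ideal.map_le_iff_le_comap]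
  exact (annihilator_moduleJ_le p).trans hQ

theorem mk_X_mem_closedPoint (i : Fin 3) :
    Ideal.Quotient.mk (exampleIdeal k) (MvPowerSeries.X i) ∈
      (IsLocalRing.closedPoint (ExampleRing k)).asIdeal := by
  change _ ∈ IsLocalRing.maximalIdeal (ExampleRing k)
  rw [maximalIdeal_eq_map_of_surjective _ Ideal.Quotient.mk_surjective, maximalIdeal_eq_varIdeal]
  exact Ideal.mem_map_of_mem _ (X_mem_varIdeal (Finset.mem_univ i))

theorem exists_comap_eq_varIdeal_one : ∃ Q : PrimeSpectrum (ExampleRing k),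
    Q.asIdeal.comap (Ideal.Quotient.mk (exampleIdeal k)) = varIdeal k {1} := by
  have hprime := Ideal.map_isPrime_of_surjective
    (f := Ideal.Quotient.mk (exampleIdeal k)) Ideal.Quotient.mk_surjective (I := varIdeal k {1})
    (by rw [Ideal.mk_ker]; exact exampleIdeal_le_varIdeal_one)
  refine ⟨⟨_, hprime⟩, ?_⟩
  change ((varIdeal k {1}).map _).comap _ = _
  rw [Ideal.comap_map_of_surjective _ Ideal.Quotient.mk_surjective, ← RingHom.ker_eq_comap_bot,
    Ideal.mk_ker, sup_eq_left.2 exampleIdeal_le_varIdeal_one]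

theorem openSubset_ssubset_fgLocus (p : ℕ) [Fact p.Prime] [CharP k p] :
    openSubset p (exampleIdeal k) ⊂ fgLocus p (ExampleRing k) := by
  rw [fgLocus_exampleRing, Set.ssubset_iff_of_subset]
  · obtain ⟨Q, hQ⟩ := exists_comap_eq_varIdeal_one (k := k)
    refine ⟨Q, ?_, notMem_openSubset_of_le p hQ.ge⟩
    rintro rfl
    have h : (MvPowerSeries.X 0 : MvPowerSeries (Fin 3) k) ∈ varIdeal k {1} :=
      hQ ▸ Ideal.mem_comap.2 (mk_X_mem_closedPoint 0)
    exact absurd (X_mem_varIdeal_iff.1 h) (by decide)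
  · rintro Q hQ rfl
    refine notMem_openSubset_of_le p (Ideal.span_le.2 ?_) hQ
    rintro _ ⟨i, -, rfl⟩
    exact mk_X_mem_closedPoint i

end ExampleLocus

end FrobeniusLocus

theorem proposition2p6 {k : Type u} [Field k] (p : ℕ) [Fact p.Prime] [CharP k p] :
    FrobeniusLocus.openSubset p (FrobeniusLocus.exampleIdeal k) ⊂
        FrobeniusLocus.fgLocus p (FrobeniusLocus.ExampleRing k) ∧
      FrobeniusLocus.fgLocus p (FrobeniusLocus.ExampleRing k) =
        {IsLocalRing.closedPoint (FrobeniusLocus.ExampleRing k)}ᶜ ∧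
      IsOpen (FrobeniusLocus.fgLocus p (FrobeniusLocus.ExampleRing k)) := by
  refine ⟨FrobeniusLocus.openSubset_ssubset_fgLocus p, FrobeniusLocus.fgLocus_exampleRing p, ?_⟩
  rw [FrobeniusLocus.fgLocus_exampleRing, isOpen_compl_iff,
    PrimeSpectrum.isClosed_singleton_iff_isMaximal]
  exact IsLocalRing.maximalIdeal.isMaximal _
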